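/- Let $d\ge 1$ and let $\Omega\subset\mathbb{R}^d$ be a compact domain which satisfies an interior cone condition and has a Lipschitz boundary. Let $k(x,y)=\Phi(x-y)$ be a translation-invariant, strictly positive definite kernel on $\Omega$ with native space (reproducing kernel Hilbert space) $\mathcal{H}_k$, and suppose that $k$ has finite smoothness $\tau>d/2$, i.e. $\mathcal{H}_k$ is norm equivalent to the Sobolev space $W_2^\tau(\Omega)$. For a finite set $X\subset\Omega$ let $V(X)=\mathrm{span}\{k(\cdot,x):x\in X\}$, let $\Pi_{V(X)}$ be the orthogonal projection of $\mathcal{H}_k$ onto $V(X)$, and let $$P_X(x)=\sup_{0\ne f\in\mathcal{H}_k}\frac{|f(x)-\Pi_{V(X)}(f)(x)|}{\|f\|_{\mathcal{H}_k}},\qquad x\in\Omega,$$ be the Power function. For $0<\gamma\le 1$, a $\gamma$-stabilized greedy algorithm starts with $X_0=\emptyset$ and sets $X_{N+1}=X_N\cup\{x_{N+1}\}$, where $x_{N+1}$ maximizes some selection criterion $\eta^{(N)}:\Omega\to[0,\infty)$, which may depend on a target function in $\mathcal{H}_k$ and on the points chosen before, over the restricted set $\{x\in\Omega: P_{X_N}(x)\ge\gamma\,\|P_{X_N}\|_\infty\}$.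 It may stop after finitely many steps. Then there is a constant $c_1>0$, depending neither on $\gamma$ nor on $N$ nor on the selection criteria, such that, with $C_P=2^{5\tau/d-1/2}\,c_1$, for every $\gamma\in(0,1]$, every $\gamma$-stabilized greedy algorithm and every $N\ge1$ for which $X_N$ has been selected, $$\|P_{X_N}\|_{L^\infty(\Omega)}\le C_P\,\gamma^{-2}\,N^{\frac12-\frac{\tau}{d}},$$ and, in particular, for all $f\in\mathcal{H}_k$, $$\|f-\Pi_{V(X_N)}(f)\|_{L^\infty(\Omega)}\le C_P\,\gamma^{-2}\,N^{\frac12-\frac{\tau}{d}}\,\|f\|_{\mathcal{H}_k}.$$ -/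

import Mathlib

open MeasureTheory Set
open scoped NNReal ENNReal ContDiff RealInnerProductSpace

noncomputable section

/-! ### Geometry of the domain -/

/-- The interior cone condition: there are an angle `θ ∈ (0, π / 2)` and a radius `r > 0` such that
every point `x` of `Ω` is the vertex of a cone `{x + t • y : ‖y‖ = 1, ⟪y, ξ⟫ ≥ cos θ, 0 ≤ t ≤ r}`,
with a unit direction `ξ` depending on `x`, that is contained in `Ω`. -/
def InteriorConeCondition {d : ℕ} (Ω : Set (EuclideanSpace ℝ (Fin d))) : Prop :=
  ∃ θ r : ℝ, 0 < θ ∧ θ < Real.pi / 2 ∧ 0 < r ∧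
    ∀ x ∈ Ω, ∃ ξ : EuclideanSpace ℝ (Fin d), ‖ξ‖ = 1 ∧
      ∀ y : EuclideanSpace ℝ (Fin d), ‖y‖ = 1 → Real.cos θ ≤ ⟪y, ξ⟫ →
        ∀ t : ℝ, 0 ≤ t → t ≤ r → x + t • y ∈ Ω

/-- `Ω` has a Lipschitz boundary: around each of its boundary points and in suitable orthonormal
coordinates, `Ω` is the region above the graph of a Lipschitz function. Here `ν` is the "vertical"
unit direction and the graph lives over the hyperplane orthogonal to `ν`. -/
def HasLipschitzBoundary {d : ℕ} (Ω : Set (EuclideanSpace ℝ (Fin d))) : Prop :=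
  ∀ x₀ ∈ frontier Ω, ∃ (ν : EuclideanSpace ℝ (Fin d)) (K : ℝ≥0)
    (φ : (Submodule.span ℝ {ν})ᗮ → ℝ) (ε : ℝ), ‖ν‖ = 1 ∧ LipschitzWith K φ ∧ 0 < ε ∧
      ∀ x ∈ Metric.ball x₀ ε,
        x ∈ Ω ↔ φ ((Submodule.span ℝ {ν})ᗮ.orthogonalProjectionOnto x) ≤ ⟪ν, x⟫

/-! ### Sobolev spaces of (possibly fractional) order on an open set -/

/-- The classical partial derivative of `φ` in the `i`-th coordinate direction. -/
def partialDeriv {d : ℕ} (i : Fin d) (φ : EuclideanSpace ℝ (Fin d) → ℝ) :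
    EuclideanSpace ℝ (Fin d) → ℝ :=
  fun x ↦ fderiv ℝ φ x (EuclideanSpace.single i 1)

/-- The classical derivative `∂₁^{α₁} ⋯ ∂_d^{α_d} φ` for a multi-index `α`. -/
def multiDeriv {d : ℕ} (α : Fin d → ℕ) (φ : EuclideanSpace ℝ (Fin d) → ℝ) :
    EuclideanSpace ℝ (Fin d) → ℝ :=
  (List.finRange d).foldr (fun i ψ ↦ (partialDeriv i)^[α i] ψ) φ

/-- `g` is a weak derivative of `u` on `U` for the multi-index `α`. -/
structure IsWeakDeriv {d : ℕ} (U : Set (EuclideanSpace ℝ (Fin d))) (α : Fin d → ℕ)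
    (u g : EuclideanSpace ℝ (Fin d) → ℝ) : Prop where
  locallyIntegrableOn_left : LocallyIntegrableOn u U
  locallyIntegrableOn_right : LocallyIntegrableOn g U
  integral_eq : ∀ φ : EuclideanSpace ℝ (Fin d) → ℝ, ContDiff ℝ ∞ φ → HasCompactSupport φ →
    tsupport φ ⊆ U →
      ∫ x in U, u x * multiDeriv α φ x = (-1) ^ (∑ i, α i) * ∫ x in U, g x * φ x

/-- The square of the Slobodeckij seminorm of order `s ∈ (0, 1)`:
`∫_U ∫_U |g x - g y|² / ‖x - y‖^(d + 2 s)`. -/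
def slobodeckijSq {d : ℕ} (s : ℝ) (U : Set (EuclideanSpace ℝ (Fin d)))
    (g : EuclideanSpace ℝ (Fin d) → ℝ) : ℝ≥0∞ :=
  ∫⁻ x in U, ∫⁻ y in U, ‖g x - g y‖ₑ ^ 2 / ‖x - y‖ₑ ^ ((d : ℝ) + 2 * s)

/-- The norm of `W_2^τ(U)`, with the value `∞` outside of this space. With `τ = m + s`, `m ∈ ℕ`,
`0 ≤ s < 1`, it is the square root of the sum of `‖D^α u‖_{L²(U)}²` over `|α| ≤ m` and, if `s > 0`,
of the squared Slobodeckij seminorms of order `s` of `D^α u` over `|α| = m`.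
The infimum runs over the families `D` of weak derivatives of `u`: these agree almost everywhere on
`U`, so all of them give the same value, and the infimum is `∞` if there are none. -/
def sobolevNorm {d : ℕ} (τ : ℝ) (U : Set (EuclideanSpace ℝ (Fin d)))
    (u : EuclideanSpace ℝ (Fin d) → ℝ) : ℝ≥0∞ :=
  ⨅ (D : (Fin d → ℕ) → EuclideanSpace ℝ (Fin d) → ℝ)
    (_ : ∀ α : Fin d → ℕ, ∑ i, α i ≤ ⌊τ⌋₊ → IsWeakDeriv U α u (D α)),
    ((∑ n ∈ Finset.range (⌊τ⌋₊ + 1), ∑ α ∈ Finset.piAntidiag (Finset.univ : Finset (Fin d)) n,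
        eLpNorm (D α) 2 (volume.restrict U) ^ 2) +
      (if τ = ⌊τ⌋₊ then 0 else
        ∑ α ∈ Finset.piAntidiag (Finset.univ : Finset (Fin d)) ⌊τ⌋₊,
          slobodeckijSq (τ - ⌊τ⌋₊) U (D α))) ^ (1 / 2 : ℝ)

/-- The norm in `W_2^τ(Ω)` of a function that is defined on `Ω` only, where, as usual, the Sobolev
space is that of the interior of `Ω` (the values outside of the interior do not matter). -/
def sobolevNormOn {d : ℕ} (τ : ℝ) (Ω : Set (EuclideanSpace ℝ (Fin d))) (g : Ω → ℝ) : ℝ≥0∞ :=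
  sobolevNorm τ (interior Ω) (Function.extend Subtype.val g 0)

/-! ### Kernels and native spaces -/

/-- A kernel is strictly positive definite if its kernel matrices on all finite sets of pairwise
distinct points are (symmetric and) positive definite. -/
def IsStrictlyPosDefKernel {X : Type*} (k : X → X → ℝ) : Prop :=
  (∀ x y, k x y = k y x) ∧ ∀ s : Finset X, (Matrix.of fun i j : s ↦ k i j).PosDef

/-- The kernel `k` on `Ω ⊆ ℝᵈ` is of the form `k(x, y) = Φ(x - y)`. -/
def IsTranslationInvariant {d : ℕ} {Ω : Set (EuclideanSpace ℝ (Fin d))} (k : Ω → Ω → ℝ) : Prop :=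
  ∃ Φ : EuclideanSpace ℝ (Fin d) → ℝ, ∀ x y : Ω, k x y = Φ (x - y)

section NativeSpace

variable {X : Type*} (H : Type*) [NormedAddCommGroup H] [InnerProductSpace ℝ H] [CompleteSpace H]
  [RKHS ℝ H X ℝ]

/-- The Riesz representer in `H` of the evaluation at `x`. For the native space of a kernel `k`
this is the function `k(·, x)`. -/
def kernelTranslate (x : X) : H := RKHS.kerFun H x (1 : ℝ)

/-- The Hilbert space `H` of functions on `X` is the native space of `k`: the functions `k(·, x)`
belong to `H` and represent the point evaluations. -/
def IsNativeSpace (k : X → X → ℝ) : Prop :=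
  ∀ x : X, ∃ kx : H, (∀ y, kx y = k y x) ∧ ∀ f : H, ⟪f, kx⟫ = f x

/-- `V(s)`, the span of the kernel translates `k(·, x)` for `x ∈ s`. -/
def kernelSpan (s : Finset X) : Submodule ℝ H :=
  Submodule.span ℝ (kernelTranslate H '' (s : Set X))

instance kernelSpan_finiteDimensional (s : Finset X) : FiniteDimensional ℝ (kernelSpan H s) :=
  FiniteDimensional.span_of_finite ℝ (s.finite_toSet.image _)

/-- The kernel interpolant of `f` on `s`: the orthogonal projection of `f` onto `V(s)`. -/
def interpolant (s : Finset X) (f : H) : H := (kernelSpan H s).starProjection f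

/-- The Power function of the point set `s`: the norm of the pointwise error functional. -/
def powerFunction (s : Finset X) (x : X) : ℝ :=
  ⨆ f : {f : H // f ≠ 0}, |f.1 x - interpolant H s f.1 x| / ‖f.1‖

end NativeSpace

/-- The kernel whose native space on `Ω` is `H` has finite smoothness `τ`: `H` is norm equivalent
to `W_2^τ(Ω)`. For `τ > d / 2` each element of `W_2^τ(Ω)` is identified with its continuous
representative, so `H` consists of the continuous functions with finite Sobolev norm. -/
def HasFiniteSmoothness {d : ℕ} {Ω : Set (EuclideanSpace ℝ (Fin d))} (H : Type*)
    [NormedAddCommGroup H] [InnerProductSpace ℝ H] [RKHS ℝ H Ω ℝ] (τ : ℝ) : Prop :=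
  (∀ g : Ω → ℝ, (∃ f : H, ⇑f = g) ↔ Continuous g ∧ sobolevNormOn τ Ω g < ⊤) ∧
    ∃ c C : ℝ, 0 < c ∧ 0 < C ∧ ∀ f : H,
      ENNReal.ofReal (c * ‖f‖) ≤ sobolevNormOn τ Ω f ∧
        sobolevNormOn τ Ω f ≤ ENNReal.ofReal (C * ‖f‖)

/-! ### Stabilized greedy algorithms -/

/-- The supremum norm of `g` over its domain, with values in `[0, ∞]`. -/
def supNorm {X : Type*} (g : X → ℝ) : ℝ≥0∞ := ⨆ x, ‖g x‖ₑ

open Classical in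
/-- The set `X_N` of the first `N` points of a sequence. -/
def firstPoints {X : Type*} (x : ℕ → X) (N : ℕ) : Finset X := (Finset.range N).image x

section Greedy

variable {X : Type*} (H : Type*) [NormedAddCommGroup H] [InnerProductSpace ℝ H] [CompleteSpace H]
  [RKHS ℝ H X ℝ]

/-- The restricted set of the points `x` with `P_s(x) ≥ γ ‖P_s‖_∞`. -/
def restrictedSet (γ : ℝ) (s : Finset X) : Set X :=
  {x | ENNReal.ofReal γ * supNorm (powerFunction H s) ≤ ‖powerFunction H s x‖ₑ}

/-- `x 0, x 1, …` are the points chosen in `M` steps (infinitely many if `M = ⊤`) by a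
`γ`-stabilized greedy algorithm with selection criterion `η N : X → [0, ∞)` at the step from `X_N`
to `X_{N+1}`: the next point `x N` maximizes `η N` over the restricted set of `X_N`.
The criteria `η N` are arbitrary; they may come from a target function and from the previously
chosen points. -/
def IsStabilizedGreedy (γ : ℝ) (η : ℕ → X → ℝ≥0) (M : ℕ∞) (x : ℕ → X) : Prop :=
  ∀ N : ℕ, (N : ℕ∞) < M →
    x N ∈ restrictedSet H γ (firstPoints x N) ∧
      ∀ y ∈ restrictedSet H γ (firstPoints x N), η N y ≤ η N (x N)

end Greedy

end

/-! The value `P_X(x)` is the distance in `H` from the kernel translate `k(·, x)` to `V(X)`, so the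
theorem compares a weak greedy selection from the set of kernel translates with the best linear
approximation of that set. Two independent facts are combined.

Width (`exists_subspace_approximating_kernelTranslate`): some space of dimension at most `(L(⌊τ⌋ +
1))^d` approximates every translate within `C L^{-(τ - d/2)}`. By duality it suffices to find that
many functionals such that any unit vector `f` which they annihilate is uniformly of size `L^{-(τ -
d/2)}`. The functionals are integrals of `f` against scaled profiles on a grid of cubes; they
generate the averaged Taylor polynomials of `f` over these cubes. That such a polynomial, evaluated
at `x`, is close to `f(x)` is `exists_bound_sub_pairing`: cubes shrink geometrically to `x` inside
the cone at `x`, two consecutive Taylor averages differ by a pairing of `∂ᵢ^m f`, `m = ⌊τ⌋`, with a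
small mean-zero function, and the differences sum like a geometric series. Mean zero yields the
fractional part of `τ`.

Selection (`exists_abs_diag_le_of_approx`): for `K` consecutive chosen points, the coordinates of
their translates in the Gram–Schmidt basis form a triangular matrix whose diagonal consists of the
values `P_{X_{N+i}}(x_{N+i})`. If the translates are `δ`-close to a space of dimension at most `K/2`
and have coordinate vectors of norm at most `s`, a volume estimate bounds the determinant by
`(2sδ)^{K/2}`, so some diagonal entry is at most `√(2sδ)`. Stabilization turns this into
`‖P_{X_{N+K}}‖ ≤ √(2sδ)/γ`.

Iterating along `N = 2(2^l n)^d`, `n = ⌊τ⌋ + 1`, with `δ` of order `2^{-l(τ - d/2)}` preserves a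
bound `A γ^{-2} 2^{-l(τ - d/2)}`: the factor `γ^{-2}` is the fixed point of `a ↦ √a/γ`. Monotonicity
of the Power function fills in the remaining `N`. -/

noncomputable section

/-! ### Averaged Taylor kernels in one variable -/

/-- A smooth cutoff, `0` to the left of `z` and `1` to the right of `z + s`, times the Taylor monomial
`(y - x) ^ m / m!`. -/
def taylorCutoff (m : ℕ) (x z s : ℝ) : ℝ → ℝ :=
  fun y ↦ (-1) ^ m / m.factorial * (Real.smoothTransition ((y - z) / s) * (x - y) ^ m)

/-- The kernel in `y` of the averaged Taylor polynomial of degree `m`, evaluated at `x` and averaged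
over `[z, z + s]`. -/
def taylorKernel (m : ℕ) (x z s : ℝ) : ℝ → ℝ := iteratedDeriv (m + 1) (taylorCutoff m x z s)

/-- The `m`-fold primitive of the difference of two averaged Taylor kernels. -/
def taylorFlux (m : ℕ) (x z s z' s' : ℝ) : ℝ → ℝ :=
  deriv (fun y ↦ taylorCutoff m x z' s' y - taylorCutoff m x z s y)

/-- The profiles of which the averaged Taylor kernels are combinations. -/
def taylorProfile (m l : ℕ) : ℝ → ℝ :=
  iteratedDeriv (m + 1) (fun u ↦ Real.smoothTransition u * u ^ l)

lemma contDiff_iteratedDeriv {f : ℝ → ℝ} (hf : ContDiff ℝ ∞ f) (k : ℕ) :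
    ContDiff ℝ ∞ (iteratedDeriv k f) := by
  rw [iteratedDeriv_eq_iterate]
  exact hf.iterate_deriv k

lemma contDiff_taylorCutoff (m : ℕ) (x z s : ℝ) : ContDiff ℝ ∞ (taylorCutoff m x z s) := by
  have : ContDiff ℝ ∞ fun y : ℝ ↦ Real.smoothTransition ((y - z) / s) :=
    Real.smoothTransition.contDiff.comp (by fun_prop)
  unfold taylorCutoff
  fun_prop

lemma contDiff_taylorKernel (m : ℕ) (x z s : ℝ) : ContDiff ℝ ∞ (taylorKernel m x z s) :=
  contDiff_iteratedDeriv (contDiff_taylorCutoff m x z s) _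

lemma contDiff_taylorFlux (m : ℕ) (x z s z' s' : ℝ) :
    ContDiff ℝ ∞ (taylorFlux m x z s z' s') := by
  have := contDiff_iteratedDeriv
    ((contDiff_taylorCutoff m x z' s').sub (contDiff_taylorCutoff m x z s)) 1
  rwa [iteratedDeriv_one] at this

lemma contDiff_smoothTransition_mul_pow (l : ℕ) :
    ContDiff ℝ ∞ (fun u : ℝ ↦ Real.smoothTransition u * u ^ l) :=
  Real.smoothTransition.contDiff.mul (by fun_prop)

lemma contDiff_taylorProfile (m l : ℕ) : ContDiff ℝ ∞ (taylorProfile m l) :=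
  contDiff_iteratedDeriv (contDiff_smoothTransition_mul_pow l) _

lemma taylorCutoff_of_le {m : ℕ} {x z s y : ℝ} (hs : 0 < s) (hy : y ≤ z) :
    taylorCutoff m x z s y = 0 := by
  rw [taylorCutoff, Real.smoothTransition.zero_of_nonpos]
  · simp
  · exact div_nonpos_of_nonpos_of_nonneg (by linarith) hs.le

lemma taylorCutoff_of_ge {m : ℕ} {x z s y : ℝ} (hs : 0 < s) (hy : z + s ≤ y) :
    taylorCutoff m x z s y = (-1) ^ m / m.factorial * (x - y) ^ m := by
  rw [taylorCutoff, Real.smoothTransition.one_of_one_le]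
  · simp
  · rw [le_div_iff₀ hs]; linarith

lemma iteratedDeriv_taylorCutoff_of_lt {m : ℕ} {x z s y : ℝ} (hs : 0 < s) (hy : y < z) (k : ℕ) :
    iteratedDeriv k (taylorCutoff m x z s) y = 0 := by
  have : taylorCutoff m x z s =ᶠ[nhds y] fun _ ↦ 0 := by
    filter_upwards [gt_mem_nhds hy] with u hu using taylorCutoff_of_le hs hu.le
  rw [this.iteratedDeriv_eq]
  simp

lemma iteratedDeriv_taylorCutoff_of_gt {m : ℕ} {x z s y : ℝ} (hs : 0 < s) (hy : z + s < y)
    (k : ℕ) : iteratedDeriv k (taylorCutoff m x z s) y =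
      (-1) ^ m / m.factorial * ((-1) ^ k * (m.descFactorial k * (x - y) ^ (m - k))) := by
  have : taylorCutoff m x z s =ᶠ[nhds y] fun u ↦ (-1) ^ m / m.factorial * (x - u) ^ m := by
    filter_upwards [lt_mem_nhds hy] with u hu using taylorCutoff_of_ge hs hu.le
  rw [this.iteratedDeriv_eq, iteratedDeriv_const_mul_field]
  have h := congrFun (iteratedDeriv_comp_const_sub k (fun u : ℝ ↦ u ^ m) x) y
  rw [h, iteratedDeriv_pow]
  simp

/-- To the right of `z + s` the cutoff is a polynomial of degree `m`, which `m + 1` derivatives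
annihilate. -/
lemma taylorKernel_eq_zero {m : ℕ} {x z s y : ℝ} (hs : 0 < s) (hy : y ∉ Icc z (z + s)) :
    taylorKernel m x z s y = 0 := by
  rw [mem_Icc, not_and_or, not_le, not_le] at hy
  rcases hy with hy | hy
  · exact iteratedDeriv_taylorCutoff_of_lt hs hy _
  · rw [taylorKernel, iteratedDeriv_taylorCutoff_of_gt hs hy]
    simp

lemma integral_deriv_of_support_subset {f : ℝ → ℝ} (hf : ContDiff ℝ ∞ f) {a b : ℝ}
    (hsupp : ∀ y ∉ Ioc a b, deriv f y = 0) : ∫ y, deriv f y = f b - f a := by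
  rw [← intervalIntegral.integral_eq_integral_of_support_subset (a := a) (b := b)]
  · refine intervalIntegral.integral_deriv_eq_sub
      (fun x _ ↦ hf.differentiable (by simp) x) ?_
    exact (hf.continuous_deriv (by simp)).intervalIntegrable _ _
  · intro y hy
    by_contra h
    exact hy (hsupp y h)

/-- The kernel is the derivative of the `m`-th derivative of the cutoff, which rises from `0` to `(y
- x)^m / m!` differentiated `m` times, that is to `1`. -/
lemma integral_taylorKernel {m : ℕ} {x z s : ℝ} (hs : 0 < s) : ∫ y, taylorKernel m x z s y = 1 := by
  have h := integral_deriv_of_support_subset (a := z - 1) (b := z + s + 1)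
    (contDiff_iteratedDeriv (contDiff_taylorCutoff m x z s) m) (fun y hy ↦ by
      rw [← iteratedDeriv_succ]
      refine taylorKernel_eq_zero hs fun h ↦ hy ⟨by linarith [h.1], by linarith [h.2]⟩)
  rw [← iteratedDeriv_succ, iteratedDeriv_taylorCutoff_of_lt (y := z - 1) hs (by linarith),
    iteratedDeriv_taylorCutoff_of_gt (y := z + s + 1) hs (by linarith)] at h
  rw [taylorKernel, h, Nat.descFactorial_self]
  have : (m.factorial : ℝ) ≠ 0 := by positivity
  field_simp
  simp [← pow_mul]

/-- Allows the difference of two Taylor averages to be integrated by parts `m` times, so that only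
derivatives of order `m` are needed. -/
lemma iteratedDeriv_taylorFlux (m : ℕ) (x z s z' s' : ℝ) :
    iteratedDeriv m (taylorFlux m x z s z' s') =
      fun y ↦ taylorKernel m x z' s' y - taylorKernel m x z s y := by
  rw [taylorFlux, ← iteratedDeriv_succ']
  ext y
  exact iteratedDeriv_sub ((contDiff_taylorCutoff m x z' s').of_le (by exact_mod_cast le_top)).contDiffAt
    ((contDiff_taylorCutoff m x z s).of_le (by exact_mod_cast le_top)).contDiffAt

/-- Both cutoffs are built from the same `x`, so beyond the two intervals they are the same
polynomial and cancel. -/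
lemma taylorFlux_eq_zero {m : ℕ} {x z s z' s' a b y : ℝ} (hs : 0 < s) (hs' : 0 < s')
    (h : Icc z (z + s) ⊆ Icc a b) (h' : Icc z' (z' + s') ⊆ Icc a b) (hy : y ∉ Icc a b) :
    taylorFlux m x z s z' s' y = 0 := by
  have hz := h (left_mem_Icc.2 (by linarith))
  have hzs := h (right_mem_Icc.2 (by linarith))
  have hz' := h' (left_mem_Icc.2 (by linarith))
  have hzs' := h' (right_mem_Icc.2 (by linarith))
  rw [mem_Icc, not_and_or, not_le, not_le] at hy
  have : (fun y ↦ taylorCutoff m x z' s' y - taylorCutoff m x z s y) =ᶠ[nhds y] fun _ ↦ 0 := by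
    rcases hy with hy | hy
    · filter_upwards [gt_mem_nhds hy] with u hu
      rw [taylorCutoff_of_le hs' (by linarith [hz'.1]), taylorCutoff_of_le hs (by linarith [hz.1]),
        sub_zero]
    · filter_upwards [lt_mem_nhds hy] with u hu
      rw [taylorCutoff_of_ge hs' (by linarith [hzs'.2]),
        taylorCutoff_of_ge hs (by linarith [hzs.2]), sub_self]
  rw [taylorFlux, this.deriv_eq]
  simp

lemma integral_taylorFlux {m : ℕ} {x z s z' s' a b : ℝ} (hs : 0 < s) (hs' : 0 < s')
    (h : Icc z (z + s) ⊆ Icc a b) (h' : Icc z' (z' + s') ⊆ Icc a b) :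
    ∫ y, taylorFlux m x z s z' s' y = 0 := by
  have hz := h (left_mem_Icc.2 (by linarith))
  have hzs := h (right_mem_Icc.2 (by linarith))
  have hz' := h' (left_mem_Icc.2 (by linarith))
  have hzs' := h' (right_mem_Icc.2 (by linarith))
  rw [taylorFlux, integral_deriv_of_support_subset (a := a - 1) (b := b + 1)
    ((contDiff_taylorCutoff m x z' s').sub (contDiff_taylorCutoff m x z s))]
  · rw [taylorCutoff_of_ge hs' (by linarith [hzs'.2]), taylorCutoff_of_ge hs (by linarith [hzs.2]),
      taylorCutoff_of_le hs' (by linarith [hz'.1]), taylorCutoff_of_le hs (by linarith [hz.1])]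
    simp
  · exact fun y hy ↦ taylorFlux_eq_zero hs hs' h h'
      fun hh ↦ hy ⟨by linarith [hh.1], by linarith [hh.2]⟩

lemma taylorProfile_eq_zero {m l : ℕ} (hl : l ≤ m) {u : ℝ} (hu : u ∉ Icc 0 1) :
    taylorProfile m l u = 0 := by
  rw [mem_Icc, not_and_or, not_le, not_le] at hu
  rcases hu with hu | hu
  · have : (fun u : ℝ ↦ Real.smoothTransition u * u ^ l) =ᶠ[nhds u] fun _ ↦ 0 := by
      filter_upwards [gt_mem_nhds hu] with v hv
      rw [Real.smoothTransition.zero_of_nonpos hv.le, zero_mul]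
    rw [taylorProfile, this.iteratedDeriv_eq]
    simp
  · have : (fun u : ℝ ↦ Real.smoothTransition u * u ^ l) =ᶠ[nhds u] fun v ↦ v ^ l := by
      filter_upwards [lt_mem_nhds hu] with v hv
      rw [Real.smoothTransition.one_of_one_le hv.le, one_mul]
    rw [taylorProfile, this.iteratedDeriv_eq, iteratedDeriv_pow]
    simp only [Nat.descFactorial_of_lt (Nat.lt_succ_of_le hl), Nat.cast_zero, zero_mul]

lemma exists_bound_of_eq_zero_off_Icc {f : ℝ → ℝ} (hf : Continuous f) {a b : ℝ}
    (h : ∀ u ∉ Icc a b, f u = 0) : ∃ C : ℝ, 0 < C ∧ ∀ u, |f u| ≤ C := by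
  obtain ⟨C, hC⟩ := isCompact_Icc.exists_bound_of_continuousOn (hf.continuousOn (s := Icc a b))
  refine ⟨|C| + 1, by positivity, fun u ↦ ?_⟩
  by_cases hu : u ∈ Icc a b
  · exact (hC u hu).trans (by linarith [le_abs_self C])
  · rw [h u hu, abs_zero]; positivity

lemma exists_bound_taylorProfile (m : ℕ) :
    ∃ C : ℝ, 0 < C ∧ ∀ l ≤ m, ∀ u, |taylorProfile m l u| ≤ C := by
  have : ∀ l, ∃ C : ℝ, 0 < C ∧ (l ≤ m → ∀ u, |taylorProfile m l u| ≤ C) := fun l ↦ by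
    by_cases hl : l ≤ m
    · obtain ⟨C, hC, h⟩ := exists_bound_of_eq_zero_off_Icc (contDiff_taylorProfile m l).continuous
        (fun u hu ↦ taylorProfile_eq_zero hl hu)
      exact ⟨C, hC, fun _ ↦ h⟩
    · exact ⟨1, one_pos, fun h ↦ absurd h hl⟩
  choose C hC h using this
  refine ⟨∑ l ∈ Finset.range (m + 1), C l, Finset.sum_pos (fun l _ ↦ hC l) (by simp),
    fun l hl u ↦ (h l hl u).trans ?_⟩
  exact Finset.single_le_sum (f := C) (fun i _ ↦ (hC i).le) (Finset.mem_range.2 (by omega))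

/-- The coefficients of the averaged Taylor kernel with respect to the profiles. -/
def taylorCoeff (m l : ℕ) (x z s : ℝ) : ℝ :=
  (-1) ^ m / m.factorial * (m.choose l * (x - z) ^ (m - l) * (-s) ^ l / s ^ (m + 1))

/-- Binomial expansion of `(x - y)^m` around `z`. The point `x` enters the coefficients only; hence
finitely many profiles per cube serve all `x`. -/
lemma taylorKernel_eq_sum {m : ℕ} {x z s : ℝ} (hs : 0 < s) (y : ℝ) :
    taylorKernel m x z s y =
      ∑ l ∈ Finset.range (m + 1), taylorCoeff m l x z s * taylorProfile m l ((y - z) / s) := by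
  have key : taylorCutoff m x z s = fun y ↦ ∑ l ∈ Finset.range (m + 1),
      ((-1) ^ m / m.factorial * (m.choose l * (x - z) ^ (m - l) * (-s) ^ l)) *
        (fun u : ℝ ↦ Real.smoothTransition u * u ^ l) (s⁻¹ * (y - z)) := by
    ext y
    have : x - y = (-s) * (s⁻¹ * (y - z)) + (x - z) := by field_simp; ring
    rw [taylorCutoff, this, add_pow, Finset.mul_sum, Finset.mul_sum,
      div_eq_inv_mul (y - z)]
    refine Finset.sum_congr rfl fun l _ ↦ ?_
    generalize s⁻¹ * (y - z) = v
    beta_reduce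
    rw [mul_pow]
    ring
  have hcd (l : ℕ) : ContDiff ℝ ∞ fun y : ℝ ↦
      (fun u : ℝ ↦ Real.smoothTransition u * u ^ l) (s⁻¹ * (y - z)) :=
    (contDiff_smoothTransition_mul_pow l).comp (by fun_prop)
  rw [taylorKernel, key, iteratedDeriv_fun_sum]
  · refine Finset.sum_congr rfl fun l _ ↦ ?_
    rw [iteratedDeriv_const_mul_field]
    have h1 := congrFun (iteratedDeriv_comp_sub_const (m + 1)
      (fun v : ℝ ↦ (fun u : ℝ ↦ Real.smoothTransition u * u ^ l) (s⁻¹ * v)) z) y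
    rw [h1]
    have h2 := congrFun (iteratedDeriv_comp_const_mul (n := m + 1)
      ((contDiff_smoothTransition_mul_pow l).of_le (by exact_mod_cast le_top)) s⁻¹) (y - z)
    rw [h2, taylorCoeff, taylorProfile, div_eq_inv_mul (y - z)]
    rw [inv_pow]; ring
  · intro l _
    exact (contDiff_const.mul ((hcd l).of_le (by exact_mod_cast le_top))).contDiffAt

/-- Scaling: `m` lengths of size at most a multiple of `t` in the numerator against `s^(m+1)` with
`s` comparable to `t`. -/
lemma exists_bound_taylorKernel (m : ℕ) {δ : ℝ} (hδ : 0 < δ) :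
    ∃ C : ℝ, 0 < C ∧ ∀ x z s t y : ℝ, 0 < t → δ * t ≤ s → s ≤ t → |x - z| ≤ 3 * t →
      |taylorKernel m x z s y| ≤ C / t := by
  obtain ⟨B, hB, hBound⟩ := exists_bound_taylorProfile m
  refine ⟨∑ l ∈ Finset.range (m + 1), (m.choose l * 3 ^ (m - l) / δ ^ (m + 1)) * B + 1, ?_, ?_⟩
  · positivity
  · intro x z s t y ht hs hst hxz
    have hs0 : 0 < s := lt_of_lt_of_le (by positivity) hs
    rw [taylorKernel_eq_sum hs0]
    have : ∑ l ∈ Finset.range (m + 1), (m.choose l * 3 ^ (m - l) / δ ^ (m + 1)) * B / t ≤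
        (∑ l ∈ Finset.range (m + 1), (m.choose l * 3 ^ (m - l) / δ ^ (m + 1)) * B + 1) / t := by
      rw [← Finset.sum_div]
      gcongr
      linarith
    refine (Finset.abs_sum_le_sum_abs _ _).trans (le_trans (Finset.sum_le_sum fun l hl ↦ ?_) this)
    have hl : l ≤ m := by simpa [Nat.lt_succ_iff] using hl
    have hf : (1 : ℝ) ≤ m.factorial := by exact_mod_cast m.factorial_pos
    rw [abs_mul, taylorCoeff, abs_mul, abs_div, abs_div, abs_mul, abs_mul, abs_pow, abs_pow, abs_pow,
      abs_pow, abs_neg, abs_neg, abs_one, one_pow, abs_of_pos hs0, Nat.abs_cast, Nat.abs_cast]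
    have h1 : (m.choose l : ℝ) * |x - z| ^ (m - l) * s ^ l / s ^ (m + 1) ≤
        m.choose l * (3 * t) ^ (m - l) * t ^ l / (δ * t) ^ (m + 1) := by gcongr
    have h2 : (m.choose l : ℝ) * (3 * t) ^ (m - l) * t ^ l / (δ * t) ^ (m + 1) =
        (m.choose l * 3 ^ (m - l) / δ ^ (m + 1)) / t := by
      rw [mul_pow, mul_pow]
      have : t ^ (m + 1) = t ^ (m - l) * t ^ l * t := by rw [← pow_add, ← pow_succ]; congr 2; omega
      rw [this]
      field_simp
    calc _ ≤ 1 * (m.choose l * (3 * t) ^ (m - l) * t ^ l / (δ * t) ^ (m + 1)) * B := by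
            gcongr
            · exact div_le_one_of_le₀ hf (by positivity)
            · exact hBound l hl _
      _ = _ := by rw [one_mul, h2]; ring

lemma exists_bound_deriv_smoothTransition :
    ∃ C : ℝ, 0 < C ∧ ∀ u, |deriv Real.smoothTransition u| ≤ C := by
  obtain ⟨C, hC, h⟩ := exists_bound_taylorProfile 0
  refine ⟨C, hC, fun u ↦ ?_⟩
  simpa [taylorProfile, iteratedDeriv_one] using h 0 le_rfl u

lemma exists_bound_deriv_taylorCutoff (m : ℕ) {δ : ℝ} (hδ : 0 < δ) :
    ∃ C : ℝ, 0 < C ∧ ∀ x z s t y : ℝ, 0 < t → δ * t ≤ s → |x - y| ≤ 3 * t →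
      |deriv (taylorCutoff m x z s) y| ≤ C * (t ^ m / t) := by
  obtain ⟨B, hB, hBound⟩ := exists_bound_deriv_smoothTransition
  refine ⟨B / δ * 3 ^ m + m * 3 ^ m, by positivity, ?_⟩
  intro x z s t y ht hs hxy
  have hs0 : 0 < s := lt_of_lt_of_le (by positivity) hs
  have hd : HasDerivAt (taylorCutoff m x z s) ((-1) ^ m / m.factorial *
      (deriv Real.smoothTransition ((y - z) / s) * (1 / s) * (x - y) ^ m +
        Real.smoothTransition ((y - z) / s) * (m * (x - y) ^ (m - 1) * (-1)))) y := by
    have h1 : HasDerivAt (fun y : ℝ ↦ (y - z) / s) (1 / s) y :=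
      ((hasDerivAt_id y).sub_const z).div_const s
    have h2 : HasDerivAt (fun y : ℝ ↦ x - y) (-1) y := by
      simpa using (hasDerivAt_id y).const_sub x
    have h3 : HasDerivAt Real.smoothTransition (deriv Real.smoothTransition ((y - z) / s))
        ((y - z) / s) :=
      ((Real.smoothTransition.contDiff (n := 1)).differentiable (by simp) _).hasDerivAt
    exact ((h3.comp y h1).mul (h2.pow m)).const_mul _
  rw [hd.deriv]
  have hf : (1 : ℝ) ≤ m.factorial := by exact_mod_cast m.factorial_pos
  have hc : |(-1 : ℝ) ^ m / m.factorial| ≤ 1 := by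
    rw [abs_div, abs_pow, abs_neg, abs_one, one_pow, Nat.abs_cast]
    exact div_le_one_of_le₀ hf (by positivity)
  have hm : (m : ℝ) * |x - y| ^ (m - 1) ≤ m * 3 ^ m * (t ^ m / t) := by
    rcases m with _ | m
    · simp
    · have : t ^ (m + 1) / t = t ^ m := by rw [pow_succ]; field_simp
      rw [this, Nat.add_sub_cancel, mul_assoc]
      gcongr
      calc |x - y| ^ m ≤ (3 * t) ^ m := by gcongr
        _ = 3 ^ m * t ^ m := mul_pow ..
        _ ≤ 3 ^ (m + 1) * t ^ m := by gcongr <;> norm_num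
  have hG0 := Real.smoothTransition.nonneg ((y - z) / s)
  have hG1 := Real.smoothTransition.le_one ((y - z) / s)
  rw [abs_mul]
  calc _ ≤ 1 * |deriv Real.smoothTransition ((y - z) / s) * (1 / s) * (x - y) ^ m +
        Real.smoothTransition ((y - z) / s) * (m * (x - y) ^ (m - 1) * (-1))| := by gcongr
    _ ≤ |deriv Real.smoothTransition ((y - z) / s)| * (1 / s) * |x - y| ^ m +
        Real.smoothTransition ((y - z) / s) * (m * |x - y| ^ (m - 1)) := by
      rw [one_mul]
      refine (abs_add_le _ _).trans (le_of_eq ?_)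
      simp [abs_mul, abs_of_pos hs0, abs_of_nonneg hG0]
    _ ≤ B * (1 / (δ * t)) * (3 * t) ^ m + 1 * (m * 3 ^ m * (t ^ m / t)) := by
      gcongr
      exact hBound _
    _ = _ := by
      rw [mul_pow]; field_simp

lemma exists_bound_taylorFlux (m : ℕ) {δ : ℝ} (hδ : 0 < δ) :
    ∃ C : ℝ, 0 < C ∧ ∀ x z s z' s' t y : ℝ, 0 < t → δ * t ≤ s → δ * t ≤ s' → |x - y| ≤ 3 * t →
      |taylorFlux m x z s z' s' y| ≤ C * (t ^ m / t) := by
  obtain ⟨C, hC, h⟩ := exists_bound_deriv_taylorCutoff m hδ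
  refine ⟨2 * C, by positivity, fun x z s z' s' t y ht hs hs' hxy ↦ ?_⟩
  have hd (z s : ℝ) : DifferentiableAt ℝ (taylorCutoff m x z s) y :=
    (contDiff_taylorCutoff m x z s).differentiable (by simp) y
  have : taylorFlux m x z s z' s' y =
      deriv (taylorCutoff m x z' s') y - deriv (taylorCutoff m x z s) y :=
    deriv_fun_sub (hd z' s') (hd z s)
  rw [this]
  refine (abs_sub _ _).trans ?_
  linarith [h x z s t y ht hs hxy, h x z' s' t y ht hs' hxy]

/-! ### Tensor products of functions of one variable -/

section Tensor

variable {d : ℕ}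

/-- The tensor product of functions of one variable. -/
def tensorFun (F : Fin d → ℝ → ℝ) (y : EuclideanSpace ℝ (Fin d)) : ℝ := ∏ i, F i (y i)

/-- The closed cube with center `c` and side `2 * r`. -/
def coordBox (c : EuclideanSpace ℝ (Fin d)) (r : ℝ) : Set (EuclideanSpace ℝ (Fin d)) :=
  {y | ∀ i, y i ∈ Icc (c i - r) (c i + r)}

lemma coordBox_eq_preimage (c : EuclideanSpace ℝ (Fin d)) (r : ℝ) :
    coordBox c r = (WithLp.ofLp : EuclideanSpace ℝ (Fin d) → Fin d → ℝ) ⁻¹'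
      Icc (fun i ↦ c i - r) (fun i ↦ c i + r) := by
  ext y
  simp [coordBox, Pi.le_def, forall_and]

lemma isClosed_coordBox (c : EuclideanSpace ℝ (Fin d)) (r : ℝ) : IsClosed (coordBox c r) := by
  rw [coordBox_eq_preimage]
  exact isClosed_Icc.preimage (PiLp.continuous_ofLp 2 _)

lemma measurableSet_coordBox (c : EuclideanSpace ℝ (Fin d)) (r : ℝ) :
    MeasurableSet (coordBox c r) := (isClosed_coordBox c r).measurableSet

lemma volume_coordBox (c : EuclideanSpace ℝ (Fin d)) (r : ℝ) :
    volume (coordBox c r) = ENNReal.ofReal (2 * r) ^ d := by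
  rw [coordBox_eq_preimage, (PiLp.volume_preserving_ofLp (Fin d)).measure_preimage
    measurableSet_Icc.nullMeasurableSet, Real.volume_Icc_pi]
  have (i : Fin d) : c i + r - (c i - r) = 2 * r := by ring
  simp [this]

lemma isCompact_coordBox (c : EuclideanSpace ℝ (Fin d)) (r : ℝ) : IsCompact (coordBox c r) := by
  have : coordBox c r = (WithLp.toLp 2 : (Fin d → ℝ) → EuclideanSpace ℝ (Fin d)) ''
      Icc (fun i ↦ c i - r) (fun i ↦ c i + r) := by
    rw [coordBox_eq_preimage]
    ext y
    constructor
    · exact fun h ↦ ⟨WithLp.ofLp y, h, rfl⟩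
    · rintro ⟨w, h, rfl⟩
      exact h
  rw [this]
  exact isCompact_Icc.image (PiLp.continuous_toLp 2 _)

lemma norm_le_of_forall_abs_le {v : EuclideanSpace ℝ (Fin d)} {r : ℝ} (hr : 0 ≤ r)
    (h : ∀ i, |v i| ≤ r) : ‖v‖ ≤ d * r := by
  rw [EuclideanSpace.norm_eq]
  refine Real.sqrt_le_iff.2 ⟨by positivity, ?_⟩
  calc ∑ i, ‖v i‖ ^ 2 ≤ ∑ _i : Fin d, r ^ 2 := by
        gcongr with i
        exact h i
    _ = d * r ^ 2 := by simp
    _ ≤ (d * r) ^ 2 := by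
        rw [mul_pow]
        gcongr
        have : d ≤ d ^ 2 := by nlinarith [Nat.zero_le d]
        exact_mod_cast this

lemma norm_sub_le_of_mem_coordBox {c y z : EuclideanSpace ℝ (Fin d)} {r : ℝ} (hr : 0 ≤ r)
    (hy : y ∈ coordBox c r) (hz : z ∈ coordBox c r) : ‖y - z‖ ≤ d * (2 * r) := by
  refine norm_le_of_forall_abs_le (by positivity) fun i ↦ ?_
  rw [PiLp.sub_apply, abs_le]
  constructor <;> linarith [(hy i).1, (hy i).2, (hz i).1, (hz i).2]

lemma coordBox_subset_closedBall (c : EuclideanSpace ℝ (Fin d)) {r : ℝ} (hr : 0 ≤ r) :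
    coordBox c r ⊆ Metric.closedBall c (d * r) := by
  intro y hy
  rw [mem_closedBall_iff_norm]
  refine norm_le_of_forall_abs_le hr fun i ↦ ?_
  rw [PiLp.sub_apply, abs_le]
  constructor <;> linarith [(hy i).1, (hy i).2]

lemma contDiff_tensorFun {F : Fin d → ℝ → ℝ} (hF : ∀ i, ContDiff ℝ ∞ (F i)) :
    ContDiff ℝ ∞ (tensorFun F) := by
  unfold tensorFun
  exact contDiff_prod fun i _ ↦ (hF i).comp (by fun_prop)

lemma tensorFun_eq_zero {F : Fin d → ℝ → ℝ} {c : EuclideanSpace ℝ (Fin d)} {r : ℝ}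
    (hF : ∀ i, ∀ u ∉ Icc (c i - r) (c i + r), F i u = 0) {y : EuclideanSpace ℝ (Fin d)}
    (hy : y ∉ coordBox c r) : tensorFun F y = 0 := by
  simp only [coordBox, mem_ofPred_eq, not_forall] at hy
  obtain ⟨i, hi⟩ := hy
  exact Finset.prod_eq_zero (Finset.mem_univ i) (hF i _ hi)

lemma tsupport_subset_coordBox {f : EuclideanSpace ℝ (Fin d) → ℝ}
    {c : EuclideanSpace ℝ (Fin d)} {r : ℝ} (hf : ∀ y ∉ coordBox c r, f y = 0) :
    tsupport f ⊆ coordBox c r :=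
  closure_minimal (fun y hy ↦ by_contra fun h ↦ hy (hf y h)) (isClosed_coordBox c r)

lemma hasCompactSupport_of_coordBox {f : EuclideanSpace ℝ (Fin d) → ℝ}
    {c : EuclideanSpace ℝ (Fin d)} {r : ℝ} (hf : ∀ y ∉ coordBox c r, f y = 0) :
    HasCompactSupport f :=
  HasCompactSupport.intro (isCompact_coordBox c r) hf

lemma integral_tensorFun (F : Fin d → ℝ → ℝ) :
    ∫ y, tensorFun F y = ∏ i, ∫ u, F i u := by
  rw [← integral_fintype_prod_volume_eq_prod]
  exact (PiLp.volume_preserving_ofLp (Fin d)).integral_comp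
    (MeasurableEquiv.toLp 2 (Fin d → ℝ)).symm.measurableEmbedding (fun w ↦ ∏ i, F i (w i))

lemma partialDeriv_tensorFun {F : Fin d → ℝ → ℝ} (hF : ∀ i, ContDiff ℝ ∞ (F i)) (i : Fin d) :
    partialDeriv i (tensorFun F) = tensorFun (Function.update F i (deriv (F i))) := by
  ext x
  rw [partialDeriv, ← ((contDiff_tensorFun hF).differentiable (by simp) x).lineDeriv_eq_fderiv,
    lineDeriv]
  have h1 : (fun t : ℝ ↦ tensorFun F (x + t • EuclideanSpace.single i 1)) =
      fun t ↦ F i (x i + t) * ∏ j ∈ Finset.univ.erase i, F j (x j) := by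
    ext t
    rw [tensorFun, ← Finset.mul_prod_erase _ _ (Finset.mem_univ i)]
    congr 1
    · simp
    · refine Finset.prod_congr rfl fun j hj ↦ ?_
      simp [Finset.ne_of_mem_erase hj]
  rw [h1, deriv_mul_const, deriv_comp_const_add, add_zero, tensorFun,
    ← Finset.mul_prod_erase _ _ (Finset.mem_univ i), Function.update_self]
  · congr 1
    refine Finset.prod_congr rfl fun j hj ↦ ?_
    rw [Function.update_of_ne (Finset.ne_of_mem_erase hj)]
  · exact ((hF i).differentiable (by simp)).comp
      (by fun_prop : Differentiable ℝ fun t : ℝ ↦ x i + t) 0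

lemma iterate_partialDeriv_tensorFun {F : Fin d → ℝ → ℝ} (hF : ∀ i, ContDiff ℝ ∞ (F i))
    (i : Fin d) (k : ℕ) : (partialDeriv i)^[k] (tensorFun F) =
      tensorFun (Function.update F i (iteratedDeriv k (F i))) := by
  induction k with
  | zero => simp
  | succ k ih =>
    rw [Function.iterate_succ_apply', ih, partialDeriv_tensorFun]
    · simp [iteratedDeriv_succ]
    · intro j
      by_cases hj : j = i
      · subst hj
        simpa using contDiff_iteratedDeriv (hF j) k
      · simpa [Function.update_of_ne hj] using hF j

lemma multiDeriv_single (i : Fin d) (k : ℕ) (φ : EuclideanSpace ℝ (Fin d) → ℝ) :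
    multiDeriv (Pi.single i k) φ = (partialDeriv i)^[k] φ := by
  have key : ∀ l : List (Fin d), l.Nodup →
      l.foldr (fun j ψ ↦ (partialDeriv j)^[(Pi.single i k : Fin d → ℕ) j] ψ) φ =
        if i ∈ l then (partialDeriv i)^[k] φ else φ := by
    intro l
    induction l with
    | nil => simp
    | cons j l ih =>
      intro hl
      rw [List.nodup_cons] at hl
      rw [List.foldr_cons, ih hl.2]
      by_cases hj : j = i
      · subst hj
        simp [hl.1]
      · have hj' : i ≠ j := fun h ↦ hj h.symm
        simp [hj']
  rw [multiDeriv, key _ (List.nodup_finRange d), if_pos (List.mem_finRange i)]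

/-- The factors of the terms of the telescoping sum of `tensorFun F' - tensorFun F`, with `G i`
in place of `F' i - F i`. -/
def mixedFactors (F F' G : Fin d → ℝ → ℝ) (i l : Fin d) : ℝ → ℝ :=
  if l < i then F l else if l = i then G i else F' l

/-- Exchanging one factor at a time leaves a difference in a single variable per term. This is why
pure derivatives `∂ᵢ^m` suffice, without mixed ones. -/
lemma tensorFun_sub_tensorFun (F F' : Fin d → ℝ → ℝ) (y : EuclideanSpace ℝ (Fin d)) :
    tensorFun F' y - tensorFun F y =
      ∑ i, tensorFun (mixedFactors F F' (fun l u ↦ F' l u - F l u) i) y := by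
  have h := Finset.prod_sub_ordered Finset.univ (fun i ↦ F' i (y i))
    (fun i ↦ F' i (y i) - F i (y i))
  simp only [sub_sub_cancel] at h
  simp only [tensorFun]
  rw [h, sub_sub_cancel]
  refine Finset.sum_congr rfl fun i _ ↦ ?_
  rw [mul_assoc, ← Finset.mul_prod_erase _ _ (Finset.mem_univ i)]
  congr 1
  · simp [mixedFactors]
  · have hdis : Disjoint (Finset.univ.filter fun j ↦ j < i) (Finset.univ.filter fun j ↦ i < j) :=
      Finset.disjoint_filter.2 fun j _ h1 h2 ↦ lt_asymm h1 h2
    have hun : Finset.univ.erase i =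
        (Finset.univ.filter fun j ↦ j < i) ∪ (Finset.univ.filter fun j ↦ i < j) := by
      ext j
      simp [lt_or_lt_iff_ne]
    rw [hun, Finset.prod_union hdis]
    congr 1
    · refine Finset.prod_congr rfl fun j hj ↦ ?_
      simp [mixedFactors, (Finset.mem_filter.1 hj).2]
    · refine Finset.prod_congr rfl fun j hj ↦ ?_
      have := (Finset.mem_filter.1 hj).2
      simp [mixedFactors, this.not_gt, this.ne']

lemma update_mixedFactors (F F' G G' : Fin d → ℝ → ℝ) (i : Fin d) :
    Function.update (mixedFactors F F' G i) i (G' i) = mixedFactors F F' G' i := by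
  ext l u
  by_cases hl : l = i
  · subst hl; simp [mixedFactors]
  · simp [mixedFactors, hl]

lemma mixedFactors_self (F F' G : Fin d → ℝ → ℝ) (i : Fin d) : mixedFactors F F' G i i = G i := by
  simp [mixedFactors]

/-- A property of the factors passes to the mixed factors. -/
lemma mixedFactors_induction {F F' G : Fin d → ℝ → ℝ} {p : Fin d → (ℝ → ℝ) → Prop} {i : Fin d}
    (hF : ∀ l, p l (F l)) (hF' : ∀ l, p l (F' l)) (hG : p i (G i)) (l : Fin d) :
    p l (mixedFactors F F' G i l) := by
  unfold mixedFactors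
  split_ifs with h1 h2
  · exact hF l
  · exact h2 ▸ hG
  · exact hF' l

end Tensor

/-! ### Pairings of weak derivatives with test functions -/

section Pairing

variable {d : ℕ}

lemma setIntegral_eq_setIntegral_coordBox {U : Set (EuclideanSpace ℝ (Fin d))} (hU : IsOpen U)
    {c : EuclideanSpace ℝ (Fin d)} {r : ℝ} (hQ : coordBox c r ⊆ U)
    {g φ : EuclideanSpace ℝ (Fin d) → ℝ} (hφ : ∀ y ∉ coordBox c r, φ y = 0) :
    ∫ y in U, g y * φ y = ∫ y in coordBox c r, g y * φ y :=
  setIntegral_eq_of_subset_of_forall_sdiff_eq_zero hU.measurableSet hQ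
    fun y hy ↦ by rw [hφ y hy.2, mul_zero]

lemma integrableOn_mul_of_coordBox {U : Set (EuclideanSpace ℝ (Fin d))}
    {c : EuclideanSpace ℝ (Fin d)} {r : ℝ} (hQ : coordBox c r ⊆ U)
    {g φ : EuclideanSpace ℝ (Fin d) → ℝ} (hg : LocallyIntegrableOn g U) (hφc : Continuous φ) :
    IntegrableOn (fun y ↦ g y * φ y) (coordBox c r) :=
  (hg.integrableOn_compact_subset hQ (isCompact_coordBox c r)).mul_continuousOn
    hφc.continuousOn (isCompact_coordBox c r)

lemma enorm_setIntegral_mul_le {c : EuclideanSpace ℝ (Fin d)} {r : ℝ}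
    {g φ : EuclideanSpace ℝ (Fin d) → ℝ} {S : ℝ} (hS : ∀ y, |φ y| ≤ S) :
    ‖∫ y in coordBox c r, g y * φ y‖ₑ ≤
      ENNReal.ofReal S * ∫⁻ y in coordBox c r, ‖g y‖ₑ := by
  refine (enorm_integral_le_lintegral_enorm _).trans ?_
  rw [← lintegral_const_mul' _ _ ENNReal.ofReal_ne_top]
  refine lintegral_mono fun y ↦ ?_
  rw [enorm_mul, mul_comm]
  gcongr
  rw [Real.enorm_eq_ofReal_abs]
  exact ENNReal.ofReal_le_ofReal (hS y)

/-- Weighted arithmetic–geometric inequality, playing the role of Cauchy–Schwarz: integrating it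
bounds an `L¹` norm by a squared `L²` norm, and the weight `l` is tuned to the scale afterwards. -/
lemma le_mul_sq_add_inv {l : ℝ} (hl : 0 < l) (a : ℝ) : |a| ≤ l * a ^ 2 + l⁻¹ := by
  have h2 : l * |a| ≤ l * (l * a ^ 2 + l⁻¹) := by
    rw [mul_add, mul_inv_cancel₀ hl.ne']
    have h : l * (l * a ^ 2) = (l * |a|) ^ 2 := by rw [mul_pow, sq_abs]; ring
    rw [h]
    nlinarith [sq_nonneg (l * |a| - 1 / 2)]
  exact le_of_mul_le_mul_left h2 hl

lemma enorm_le_mul_sq_add_inv {l : ℝ} (hl : 0 < l) (a : ℝ) :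
    ‖a‖ₑ ≤ ENNReal.ofReal l * ‖a‖ₑ ^ 2 + ENNReal.ofReal l⁻¹ := by
  rw [Real.enorm_eq_ofReal_abs, ← ENNReal.ofReal_pow (abs_nonneg a), ← ENNReal.ofReal_mul hl.le,
    ← ENNReal.ofReal_add (by positivity) (by positivity), sq_abs]
  exact ENNReal.ofReal_le_ofReal (le_mul_sq_add_inv hl a)

lemma abs_setIntegral_mul_le_of_lintegral_sq {U : Set (EuclideanSpace ℝ (Fin d))} (hU : IsOpen U)
    {c : EuclideanSpace ℝ (Fin d)} {r : ℝ} (hr : 0 ≤ r) (hQ : coordBox c r ⊆ U)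
    {g φ : EuclideanSpace ℝ (Fin d) → ℝ} {S A l : ℝ} (hS0 : 0 ≤ S) (hA : 0 ≤ A) (hl : 0 < l)
    (hg : ∫⁻ y in U, ‖g y‖ₑ ^ 2 ≤ ENNReal.ofReal A)
    (hφ : ∀ y ∉ coordBox c r, φ y = 0) (hS : ∀ y, |φ y| ≤ S) :
    |∫ y in U, g y * φ y| ≤ S * (l * A + l⁻¹ * (2 * r) ^ d) := by
  rw [setIntegral_eq_setIntegral_coordBox hU hQ hφ]
  rw [← ENNReal.ofReal_le_ofReal_iff (by positivity), ← Real.enorm_eq_ofReal_abs]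
  refine (enorm_setIntegral_mul_le hS).trans ?_
  rw [ENNReal.ofReal_mul hS0, ENNReal.ofReal_add (by positivity) (by positivity),
    ENNReal.ofReal_mul hl.le, ENNReal.ofReal_mul (by positivity), ENNReal.ofReal_pow (by positivity)]
  gcongr
  calc ∫⁻ y in coordBox c r, ‖g y‖ₑ ≤
      ∫⁻ y in coordBox c r, (ENNReal.ofReal l * ‖g y‖ₑ ^ 2 + ENNReal.ofReal l⁻¹) :=
        lintegral_mono fun y ↦ enorm_le_mul_sq_add_inv hl _
    _ = ENNReal.ofReal l * (∫⁻ y in coordBox c r, ‖g y‖ₑ ^ 2) +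
        ENNReal.ofReal l⁻¹ * ENNReal.ofReal (2 * r) ^ d := by
        rw [lintegral_add_right _ measurable_const, lintegral_const_mul' _ _ ENNReal.ofReal_ne_top,
          lintegral_const, Measure.restrict_apply_univ, volume_coordBox]
    _ ≤ _ := by
        gcongr
        exact (lintegral_mono_set hQ).trans hg

lemma enorm_sub_le_mul_div_add {l D : ℝ} (hl : 0 < l) (hD : 0 ≤ D) {p : ℝ} (hp : 0 < p) {a b : ℝ}
    {v : EuclideanSpace ℝ (Fin d)} (hv : ‖v‖ ≤ D) (hv0 : v = 0 → a = b) :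
    ‖a - b‖ₑ ≤ ENNReal.ofReal l * (‖a - b‖ₑ ^ 2 / ‖v‖ₑ ^ p) + ENNReal.ofReal (l⁻¹ * D ^ p) := by
  by_cases h0 : v = 0
  · simp [hv0 h0]
  have hvpos : 0 < ‖v‖ := norm_pos_iff.2 h0
  have hvp : 0 < ‖v‖ ^ p := Real.rpow_pos_of_pos hvpos p
  have h1 : ‖v‖ₑ ^ p = ENNReal.ofReal (‖v‖ ^ p) := by
    rw [← ofReal_norm, ENNReal.ofReal_rpow_of_nonneg hvpos.le hp.le]
  rw [h1, Real.enorm_eq_ofReal_abs, ← ENNReal.ofReal_pow (abs_nonneg _),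
    ← ENNReal.ofReal_div_of_pos hvp, ← ENNReal.ofReal_mul hl.le,
    ← ENNReal.ofReal_add (by positivity) (by positivity), sq_abs]
  refine ENNReal.ofReal_le_ofReal ?_
  have h2 := le_mul_sq_add_inv (l := l / ‖v‖ ^ p) (by positivity) (a - b)
  have h3 : ‖v‖ ^ p ≤ D ^ p := by gcongr
  calc |a - b| ≤ l / ‖v‖ ^ p * (a - b) ^ 2 + (l / ‖v‖ ^ p)⁻¹ := h2
    _ = l * ((a - b) ^ 2 / ‖v‖ ^ p) + l⁻¹ * ‖v‖ ^ p := by field_simp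
    _ ≤ _ := by gcongr

/-- Since `φ` has mean zero, `g y` may be replaced by `g y - g z` for any `z` in the cube.
Integrating over `z` produces the double integral of the seminorm, and the volume factor on the
left. -/
lemma abs_setIntegral_mul_le_of_slobodeckijSq {U : Set (EuclideanSpace ℝ (Fin d))} (hU : IsOpen U)
    {c : EuclideanSpace ℝ (Fin d)} {r : ℝ} (hr : 0 < r) (hQ : coordBox c r ⊆ U)
    {g φ : EuclideanSpace ℝ (Fin d) → ℝ} {S A l s : ℝ} (hS0 : 0 ≤ S) (hA : 0 ≤ A) (hl : 0 < l)
    (hs : 0 < s) (hgi : LocallyIntegrableOn g U) (hg : slobodeckijSq s U g ≤ ENNReal.ofReal A)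
    (hφc : Continuous φ) (hφ : ∀ y ∉ coordBox c r, φ y = 0) (hS : ∀ y, |φ y| ≤ S)
    (hφ0 : ∫ y, φ y = 0) :
    (2 * r) ^ d * |∫ y in U, g y * φ y| ≤
      S * (l * A + l⁻¹ * (d * (2 * r)) ^ (d + 2 * s) * ((2 * r) ^ d * (2 * r) ^ d)) := by
  set p : ℝ := d + 2 * s with hp
  have hp0 : 0 < p := by positivity
  set I := ∫ y in U, g y * φ y with hI
  set Q := coordBox c r with hQdef
  have hφint : ∫ y in Q, φ y = 0 := by
    rw [setIntegral_eq_integral_of_forall_compl_eq_zero hφ, hφ0]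
  have hIz (z : EuclideanSpace ℝ (Fin d)) : I = ∫ y in Q, (g y - g z) * φ y := by
    have h1 := integrableOn_mul_of_coordBox hQ hgi hφc
    have h2 : IntegrableOn (fun y ↦ g z * φ y) Q :=
      (continuous_const.mul hφc).continuousOn.integrableOn_compact (isCompact_coordBox c r)
    simp_rw [sub_mul]
    rw [integral_sub h1 h2, integral_const_mul, hφint, mul_zero, sub_zero, hI,
      setIntegral_eq_setIntegral_coordBox hU hQ hφ]
  have hIz' (z : EuclideanSpace ℝ (Fin d)) :
      ‖I‖ₑ ≤ ENNReal.ofReal S * ∫⁻ y in Q, ‖g z - g y‖ₑ := by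
    rw [hIz z]
    refine (enorm_setIntegral_mul_le hS).trans (le_of_eq ?_)
    congr 1
    exact lintegral_congr fun y ↦ enorm_sub_rev _ _
  have hvol : volume Q = ENNReal.ofReal ((2 * r) ^ d) := by
    rw [hQdef, volume_coordBox, ENNReal.ofReal_pow (by positivity)]
  rw [← ENNReal.ofReal_le_ofReal_iff (by positivity), ENNReal.ofReal_mul (by positivity),
    ← Real.enorm_eq_ofReal_abs, ← hvol]
  have key : ∫⁻ z in Q, ∫⁻ y in Q, ‖g z - g y‖ₑ ≤
      ENNReal.ofReal (l * A + l⁻¹ * (d * (2 * r)) ^ p * ((2 * r) ^ d * (2 * r) ^ d)) := by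
    calc ∫⁻ z in Q, ∫⁻ y in Q, ‖g z - g y‖ₑ
        ≤ ∫⁻ z in Q, ∫⁻ y in Q, (ENNReal.ofReal l * (‖g z - g y‖ₑ ^ 2 / ‖z - y‖ₑ ^ p) +
            ENNReal.ofReal (l⁻¹ * (d * (2 * r)) ^ p)) := by
          refine setLIntegral_mono' (measurableSet_coordBox c r) fun z hz ↦ ?_
          refine setLIntegral_mono' (measurableSet_coordBox c r) fun y hy ↦ ?_
          refine enorm_sub_le_mul_div_add hl (by positivity) hp0
            (norm_sub_le_of_mem_coordBox hr.le hz hy) fun h ↦ ?_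
          rw [sub_eq_zero.1 h]
      _ = ENNReal.ofReal l * (∫⁻ z in Q, ∫⁻ y in Q, ‖g z - g y‖ₑ ^ 2 / ‖z - y‖ₑ ^ p) +
            ENNReal.ofReal (l⁻¹ * (d * (2 * r)) ^ p * ((2 * r) ^ d * (2 * r) ^ d)) := by
          simp_rw [lintegral_add_right _ measurable_const,
            lintegral_const_mul' _ _ ENNReal.ofReal_ne_top, lintegral_const,
            Measure.restrict_apply_univ, hvol]
          rw [mul_assoc, ← ENNReal.ofReal_mul (by positivity), ← ENNReal.ofReal_mul (by positivity),
            mul_assoc]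
      _ ≤ ENNReal.ofReal l * ENNReal.ofReal A +
            ENNReal.ofReal (l⁻¹ * (d * (2 * r)) ^ p * ((2 * r) ^ d * (2 * r) ^ d)) := by
          gcongr
          refine le_trans ?_ hg
          exact (lintegral_mono fun z ↦ lintegral_mono_set hQ).trans (lintegral_mono_set hQ)
      _ = _ := by
          rw [← ENNReal.ofReal_mul hl.le, ← ENNReal.ofReal_add (by positivity) (by positivity)]
  calc volume Q * ‖I‖ₑ = ∫⁻ z in Q, ‖I‖ₑ := by
        rw [lintegral_const, Measure.restrict_apply_univ, mul_comm]
    _ ≤ ∫⁻ z in Q, ENNReal.ofReal S * ∫⁻ y in Q, ‖g z - g y‖ₑ := lintegral_mono hIz'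
    _ = ENNReal.ofReal S * ∫⁻ z in Q, ∫⁻ y in Q, ‖g z - g y‖ₑ :=
        lintegral_const_mul' _ _ ENNReal.ofReal_ne_top
    _ ≤ _ := by
        rw [ENNReal.ofReal_mul hS0]
        gcongr

/-- `u` has weak derivatives `∂ᵢ^m u`, `m = ⌊τ⌋`, whose squared `L²` norms and, for fractional `τ`,
squared Slobodeckij seminorms of order `τ - m` are at most `A`. -/
def PureDerivBound (τ A : ℝ) (U : Set (EuclideanSpace ℝ (Fin d)))
    (u : EuclideanSpace ℝ (Fin d) → ℝ) : Prop :=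
  ∀ i : Fin d, ∃ g, IsWeakDeriv U (Pi.single i ⌊τ⌋₊) u g ∧
    ∫⁻ y in U, ‖g y‖ₑ ^ 2 ≤ ENNReal.ofReal A ∧
      (τ ≠ ⌊τ⌋₊ → slobodeckijSq (τ - ⌊τ⌋₊) U g ≤ ENNReal.ofReal A)

lemma exists_bound_pairing {τ ρ A S : ℝ} (hτ : 0 < τ) (hρ : 0 < ρ) (hA : 0 ≤ A)
    (hS : 0 ≤ S) : ∃ C : ℝ, 0 < C ∧ ∀ (U : Set (EuclideanSpace ℝ (Fin d)))
      (c : EuclideanSpace ℝ (Fin d)) (t : ℝ) (g φ : EuclideanSpace ℝ (Fin d) → ℝ),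
      IsOpen U → 0 < t → coordBox c (ρ * t) ⊆ U → LocallyIntegrableOn g U →
      ∫⁻ y in U, ‖g y‖ₑ ^ 2 ≤ ENNReal.ofReal A →
      (τ ≠ ⌊τ⌋₊ → slobodeckijSq (τ - ⌊τ⌋₊) U g ≤ ENNReal.ofReal A) →
      Continuous φ → (∀ y ∉ coordBox c (ρ * t), φ y = 0) →
      (∀ y, |φ y| ≤ S * (t ^ ⌊τ⌋₊ / t ^ d)) → ∫ y, φ y = 0 →
      |∫ y in U, g y * φ y| ≤ C * t ^ (τ - d / 2) := by
  by_cases hint : τ = ⌊τ⌋₊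
  · refine ⟨S * (A + (2 * ρ) ^ d) + 1, by positivity, ?_⟩
    intro U c t g φ hU ht hQ hgi hg hgs hφc hφ hφS hφ0
    have h := abs_setIntegral_mul_le_of_lintegral_sq hU (by positivity) hQ
      -- This weight gives `l` and `l⁻¹ t^d` the same order in `t`.
      (S := S * (t ^ ⌊τ⌋₊ / t ^ d)) (l := t ^ ((d : ℝ) / 2)) (by positivity) hA
      (Real.rpow_pos_of_pos ht _) hg hφ hφS
    refine h.trans ?_
    have e1 : t ^ (τ - d / 2) = t ^ ⌊τ⌋₊ / t ^ d * t ^ ((d : ℝ) / 2) := by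
      rw [← Real.rpow_natCast t ⌊τ⌋₊, ← hint, ← Real.rpow_natCast t d, ← Real.rpow_sub ht,
        ← Real.rpow_add ht]
      congr 1; ring
    have e2 : (t ^ ((d : ℝ) / 2))⁻¹ * t ^ d = t ^ ((d : ℝ) / 2) := by
      rw [← Real.rpow_natCast t d, ← Real.rpow_neg ht.le, ← Real.rpow_add ht]
      congr 1; ring
    have e3 : (t ^ ((d : ℝ) / 2))⁻¹ * (2 * (ρ * t)) ^ d = (2 * ρ) ^ d * t ^ ((d : ℝ) / 2) := by
      rw [← mul_assoc, mul_pow _ t, mul_left_comm, e2]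
    rw [e1, e3]
    have : 0 ≤ t ^ ⌊τ⌋₊ / t ^ d * t ^ ((d : ℝ) / 2) := by positivity
    calc _ = S * (A + (2 * ρ) ^ d) * (t ^ ⌊τ⌋₊ / t ^ d * t ^ ((d : ℝ) / 2)) := by ring
      _ ≤ _ := by gcongr; linarith
  · set s := τ - ⌊τ⌋₊ with hs
    have hs0 : 0 < s := sub_pos.2 (lt_of_le_of_ne (Nat.floor_le hτ.le) (Ne.symm hint))
    set B := A + (d * (2 * ρ)) ^ (d + 2 * s) * ((2 * ρ) ^ d * (2 * ρ) ^ d) with hB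
    refine ⟨S * B / (2 * ρ) ^ d + 1, by positivity, ?_⟩
    intro U c t g φ hU ht hQ hgi hg hgs hφc hφ hφS hφ0
    have h := abs_setIntegral_mul_le_of_slobodeckijSq hU (by positivity) hQ
      -- This weight balances `l` against `l⁻¹ t^(d + 2s) t^(2d)`.
      (S := S * (t ^ ⌊τ⌋₊ / t ^ d)) (l := t ^ ((3 * d + 2 * s) / 2)) (by positivity) hA
      (Real.rpow_pos_of_pos ht _) hs0 hgi (hgs hint) hφc hφ hφS hφ0
    have e1 : t ^ d * t ^ (τ - d / 2) = t ^ ⌊τ⌋₊ / t ^ d * t ^ ((3 * d + 2 * s) / 2) := by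
      rw [← Real.rpow_natCast t ⌊τ⌋₊, ← Real.rpow_natCast t d, ← Real.rpow_sub ht,
        ← Real.rpow_add ht, ← Real.rpow_add ht]
      congr 1; rw [hs]; ring
    have e2 : (t ^ ((3 * d + 2 * s) / 2))⁻¹ * (t ^ (d + 2 * s) * (t ^ d * t ^ d)) =
        t ^ ((3 * d + 2 * s) / 2) := by
      rw [← Real.rpow_natCast t d, ← Real.rpow_neg ht.le, ← Real.rpow_add ht, ← Real.rpow_add ht,
        ← Real.rpow_add ht]
      congr 1; ring
    have e3 : (t ^ ((3 * d + 2 * s) / 2))⁻¹ * (d * (2 * (ρ * t))) ^ (d + 2 * s) *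
        ((2 * (ρ * t)) ^ d * (2 * (ρ * t)) ^ d) = (d * (2 * ρ)) ^ (d + 2 * s) *
          ((2 * ρ) ^ d * (2 * ρ) ^ d) * t ^ ((3 * d + 2 * s) / 2) := by
      rw [show d * (2 * (ρ * t)) = d * (2 * ρ) * t by ring, Real.mul_rpow (by positivity) ht.le,
        show 2 * (ρ * t) = 2 * ρ * t by ring, mul_pow _ t]
      calc _ = (d * (2 * ρ)) ^ (d + 2 * s) * ((2 * ρ) ^ d * (2 * ρ) ^ d) *
          ((t ^ ((3 * d + 2 * s) / 2))⁻¹ * (t ^ (d + 2 * s) * (t ^ d * t ^ d))) := by ring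
        _ = _ := by rw [e2]
    rw [e3] at h
    have hpos : 0 < (2 * (ρ * t)) ^ d := by positivity
    refine le_of_mul_le_mul_left (h.trans ?_) hpos
    have e4 : (2 * (ρ * t)) ^ d * ((S * B / (2 * ρ) ^ d + 1) * t ^ (τ - d / 2)) =
        (S * B + (2 * ρ) ^ d) * (t ^ d * t ^ (τ - d / 2)) := by
      rw [show 2 * (ρ * t) = 2 * ρ * t by ring, mul_pow _ t]
      field_simp
    rw [e4, e1]
    have : 0 ≤ t ^ ⌊τ⌋₊ / t ^ d * t ^ ((3 * d + 2 * s) / 2) := by positivity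
    calc _ = S * B * (t ^ ⌊τ⌋₊ / t ^ d * t ^ ((3 * d + 2 * s) / 2)) := by rw [hB]; ring
      _ ≤ _ := by gcongr; linarith [show 0 < (2 * ρ) ^ d by positivity]

/-- The Sobolev norm is an infimum over families of weak derivatives; the strict inequality provides
an actual family below `B`. -/
lemma pureDerivBound_of_sobolevNorm_lt {τ B : ℝ} (hB : 0 ≤ B)
    {U : Set (EuclideanSpace ℝ (Fin d))} {u : EuclideanSpace ℝ (Fin d) → ℝ}
    (h : sobolevNorm τ U u < ENNReal.ofReal B) : PureDerivBound τ (B ^ 2) U u := by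
  rw [sobolevNorm] at h
  simp only [iInf_lt_iff] at h
  obtain ⟨D, hD, hlt⟩ := h
  have hle := ENNReal.rpow_le_rpow hlt.le (show (0 : ℝ) ≤ 2 by norm_num)
  rw [← ENNReal.rpow_mul, show (1 / 2 : ℝ) * 2 = 1 by norm_num, ENNReal.rpow_one,
    ENNReal.ofReal_rpow_of_nonneg hB (by norm_num), Real.rpow_two] at hle
  intro i
  have hmem : Pi.single i ⌊τ⌋₊ ∈
      Finset.piAntidiag (Finset.univ : Finset (Fin d)) ⌊τ⌋₊ := by
    simp [Finset.mem_piAntidiag]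
  refine ⟨D (Pi.single i ⌊τ⌋₊), hD _ (by simp), ?_, fun hne ↦ ?_⟩
  · refine le_trans ?_ (le_self_add.trans hle)
    refine le_trans ?_ (Finset.single_le_sum (fun _ _ ↦ zero_le) (Finset.self_mem_range_succ _))
    refine le_trans (le_of_eq ?_) (Finset.single_le_sum (fun _ _ ↦ zero_le) hmem)
    rw [eLpNorm_eq_lintegral_rpow_enorm_toReal (by norm_num) (by norm_num)]
    simp only [ENNReal.toReal_ofNat, ENNReal.rpow_ofNat]
    rw [← ENNReal.rpow_natCast, ← ENNReal.rpow_mul]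
    norm_num
  · rw [if_neg hne] at hle
    exact le_trans (Finset.single_le_sum (f := fun α ↦ slobodeckijSq (τ - ⌊τ⌋₊) U (D α))
      (fun _ _ ↦ zero_le) hmem) (le_add_self.trans hle)

end Pairing

/-! ### Local polynomial reproduction and its error -/

section LocalReproduction

variable {d : ℕ}

/-- The tensor product of the averaged Taylor kernels at the coordinates of `x`, over the cube
with corner `z` and side `s`. -/
def taylorTensor (m : ℕ) (x z : EuclideanSpace ℝ (Fin d)) (s : ℝ) :
    EuclideanSpace ℝ (Fin d) → ℝ :=
  tensorFun fun i ↦ taylorKernel m (x i) (z i) s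

/-- The cube with corner `z` and side `s ∈ [δ * t, t]` lies in the cube with center `c` and half
side `ρ * t`, whose points are, in each coordinate, within `3 * t` of `x`. -/
structure IsAdmissibleCube (δ ρ t : ℝ) (x c z : EuclideanSpace ℝ (Fin d)) (s : ℝ) : Prop where
  le_side : δ * t ≤ s
  side_le : s ≤ t
  Icc_subset : ∀ i, Icc (z i) (z i + s) ⊆ Icc (c i - ρ * t) (c i + ρ * t)
  abs_sub_le : ∀ i, ∀ v ∈ Icc (c i - ρ * t) (c i + ρ * t), |x i - v| ≤ 3 * t

lemma contDiff_taylorTensor (m : ℕ) (x z : EuclideanSpace ℝ (Fin d)) (s : ℝ) :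
    ContDiff ℝ ∞ (taylorTensor m x z s) :=
  contDiff_tensorFun fun _ ↦ contDiff_taylorKernel ..

namespace IsAdmissibleCube

variable {δ ρ t s : ℝ} {x c z : EuclideanSpace ℝ (Fin d)}

lemma side_pos (h : IsAdmissibleCube δ ρ t x c z s) (hδ : 0 < δ) (ht : 0 < t) : 0 < s :=
  lt_of_lt_of_le (by positivity) h.le_side

lemma taylorKernel_eq_zero (h : IsAdmissibleCube δ ρ t x c z s) (hδ : 0 < δ) (ht : 0 < t) (m : ℕ)
    (i : Fin d) : ∀ v ∉ Icc (c i - ρ * t) (c i + ρ * t), taylorKernel m (x i) (z i) s v = 0 :=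
  fun _ hv ↦ _root_.taylorKernel_eq_zero (h.side_pos hδ ht) fun hv' ↦ hv (h.Icc_subset i hv')

lemma taylorTensor_eq_zero (h : IsAdmissibleCube δ ρ t x c z s) (hδ : 0 < δ) (ht : 0 < t) (m : ℕ) :
    ∀ y ∉ coordBox c (ρ * t), taylorTensor m x z s y = 0 :=
  fun _ hy ↦ tensorFun_eq_zero (fun i ↦ h.taylorKernel_eq_zero hδ ht m i) hy

lemma integral_taylorTensor (h : IsAdmissibleCube δ ρ t x c z s) (hδ : 0 < δ) (ht : 0 < t)
    (m : ℕ) : ∫ y, taylorTensor m x z s y = 1 := by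
  rw [taylorTensor, integral_tensorFun]
  exact Finset.prod_eq_one fun i _ ↦ integral_taylorKernel (h.side_pos hδ ht)

lemma abs_sub_corner_le (h : IsAdmissibleCube δ ρ t x c z s) (hδ : 0 < δ) (ht : 0 < t)
    (i : Fin d) : |x i - z i| ≤ 3 * t :=
  h.abs_sub_le i _ (h.Icc_subset i (left_mem_Icc.2 (by linarith [h.side_pos hδ ht])))

end IsAdmissibleCube

/-- The kernel has integral one and is at most of order `t^(-d)` on a cube of volume of order `t^d`,
so its `L¹` norm is bounded independently of `t`. -/
lemma exists_bound_pairing_sub (m : ℕ) {δ ρ : ℝ} (hδ : 0 < δ) (hρ : 0 < ρ) :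
    ∃ C : ℝ, 0 < C ∧ ∀ (U : Set (EuclideanSpace ℝ (Fin d)))
      (u : EuclideanSpace ℝ (Fin d) → ℝ) (x c z : EuclideanSpace ℝ (Fin d)) (s t b a : ℝ),
      IsOpen U → 0 < t → IsAdmissibleCube δ ρ t x c z s → coordBox c (ρ * t) ⊆ U →
      LocallyIntegrableOn u U → (∀ y ∈ coordBox c (ρ * t), |u y - a| ≤ b) →
      |(∫ y in U, u y * taylorTensor m x z s y) - a| ≤ C * b := by
  obtain ⟨K, hK, hKb⟩ := exists_bound_taylorKernel m hδ
  refine ⟨K ^ d * (2 * ρ) ^ d, by positivity, ?_⟩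
  intro U u x c z s t b a hU ht hadm hQ hu hb
  have hzero := hadm.taylorTensor_eq_zero hδ ht m
  have hcont := (contDiff_taylorTensor m x z s).continuous
  have hbd (y) : |taylorTensor m x z s y| ≤ (K / t) ^ d := by
    rw [taylorTensor, tensorFun, Finset.abs_prod]
    calc ∏ i, |taylorKernel m (x i) (z i) s (y i)| ≤ ∏ _i : Fin d, K / t :=
          Finset.prod_le_prod (fun _ _ ↦ abs_nonneg _) fun i _ ↦
            hKb _ _ _ _ _ ht hadm.le_side hadm.side_le (hadm.abs_sub_corner_le hδ ht i)
      _ = _ := by simp [div_pow]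
  have h1 := integrableOn_mul_of_coordBox hQ hu hcont
  have h2 : IntegrableOn (fun y ↦ a * taylorTensor m x z s y) (coordBox c (ρ * t)) :=
    (continuous_const.mul hcont).continuousOn.integrableOn_compact (isCompact_coordBox _ _)
  have h3 : (∫ y in U, u y * taylorTensor m x z s y) - a =
      ∫ y in coordBox c (ρ * t), (u y - a) * taylorTensor m x z s y := by
    simp_rw [sub_mul]
    rw [integral_sub h1 h2, integral_const_mul,
      setIntegral_eq_integral_of_forall_compl_eq_zero hzero, hadm.integral_taylorTensor hδ ht,
      mul_one, setIntegral_eq_setIntegral_coordBox hU hQ hzero]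
  rw [h3, ← Real.norm_eq_abs]
  have hvol : volume.real (coordBox c (ρ * t)) = (2 * (ρ * t)) ^ d := by
    rw [Measure.real, volume_coordBox, ENNReal.toReal_pow, ENNReal.toReal_ofReal (by positivity)]
  refine (norm_setIntegral_le_of_norm_le_const (C := b * (K / t) ^ d) ?_ fun y hy ↦ ?_).trans
    (le_of_eq ?_)
  · rw [volume_coordBox]
    exact ENNReal.pow_lt_top ENNReal.ofReal_lt_top
  · rw [norm_mul, Real.norm_eq_abs, Real.norm_eq_abs]
    exact mul_le_mul (hb y hy) (hbd y) (abs_nonneg _) ((abs_nonneg _).trans (hb y hy))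
  · rw [hvol, show 2 * (ρ * t) = 2 * ρ * t by ring, mul_pow _ t, div_pow]
    field_simp

lemma exists_bound_pairing_step {τ δ ρ A : ℝ} (hτ : 0 < τ) (hδ : 0 < δ) (hρ : 0 < ρ)
    (hA : 0 ≤ A) : ∃ C : ℝ, 0 < C ∧ ∀ (U : Set (EuclideanSpace ℝ (Fin d)))
      (u : EuclideanSpace ℝ (Fin d) → ℝ) (x c z z' : EuclideanSpace ℝ (Fin d)) (s s' t : ℝ),
      IsOpen U → 0 < t → IsAdmissibleCube δ ρ t x c z s → IsAdmissibleCube δ ρ t x c z' s' →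
      coordBox c (ρ * t) ⊆ U → LocallyIntegrableOn u U → PureDerivBound τ A U u →
      |(∫ y in U, u y * taylorTensor ⌊τ⌋₊ x z' s' y) - ∫ y in U, u y * taylorTensor ⌊τ⌋₊ x z s y| ≤
        C * t ^ (τ - d / 2) := by
  set m := ⌊τ⌋₊ with hm
  obtain ⟨K₁, hK₁, hKb₁⟩ := exists_bound_taylorKernel m hδ
  obtain ⟨K₂, hK₂, hKb₂⟩ := exists_bound_taylorFlux m hδ
  set K := max K₁ K₂ with hK
  have hK0 : 0 < K := lt_max_of_lt_left hK₁
  obtain ⟨C, hC, hCb⟩ := exists_bound_pairing (d := d) hτ hρ hA (S := K ^ d) (by positivity)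
  refine ⟨d * C + 1, by positivity, ?_⟩
  intro U u x c z z' s s' t hU ht hadm hadm' hQ hu hder
  have hs := hadm.side_pos hδ ht
  have hs' := hadm'.side_pos hδ ht
  set F : Fin d → ℝ → ℝ := fun i ↦ taylorKernel m (x i) (z i) s with hF
  set F' : Fin d → ℝ → ℝ := fun i ↦ taylorKernel m (x i) (z' i) s' with hF'
  set G : Fin d → ℝ → ℝ := fun i ↦ taylorFlux m (x i) (z i) s (z' i) s' with hG
  -- The `i`-th telescoping term is `∂ᵢ^m` of `φ i`: only the factor in the `i`-th variable is
  -- replaced by its `m`-fold primitive. Thus `φ i` has size `t^m / t^d`, and it has mean zero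
  -- because the flux has.
  set φ : Fin d → EuclideanSpace ℝ (Fin d) → ℝ := fun i ↦ tensorFun (mixedFactors F F' G i) with hφ
  have hfacsmooth (i l : Fin d) : ContDiff ℝ ∞ (mixedFactors F F' G i l) :=
    mixedFactors_induction (p := fun _ f ↦ ContDiff ℝ ∞ f) (fun _ ↦ contDiff_taylorKernel ..)
      (fun _ ↦ contDiff_taylorKernel ..) (contDiff_taylorFlux ..) l
  have hsmooth (i : Fin d) : ContDiff ℝ ∞ (φ i) := contDiff_tensorFun (hfacsmooth i)
  have hGzero (i : Fin d) : ∀ v ∉ Icc (c i - ρ * t) (c i + ρ * t), G i v = 0 := fun v hv ↦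
    taylorFlux_eq_zero hs hs' (hadm.Icc_subset i) (hadm'.Icc_subset i) hv
  have hfaczero (i l : Fin d) : ∀ v ∉ Icc (c l - ρ * t) (c l + ρ * t),
      mixedFactors F F' G i l v = 0 :=
    mixedFactors_induction (p := fun l f ↦ ∀ v ∉ Icc (c l - ρ * t) (c l + ρ * t), f v = 0)
      (fun l ↦ hadm.taylorKernel_eq_zero hδ ht m l) (fun l ↦ hadm'.taylorKernel_eq_zero hδ ht m l)
      (hGzero i) l
  have hφzero (i : Fin d) : ∀ y ∉ coordBox c (ρ * t), φ i y = 0 := fun y hy ↦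
    tensorFun_eq_zero (hfaczero i) hy
  have hφbd (i : Fin d) (y : EuclideanSpace ℝ (Fin d)) : |φ i y| ≤ K ^ d * (t ^ m / t ^ d) := by
    by_cases hy : y ∈ coordBox c (ρ * t)
    · have hG' : |G i (y i)| ≤ K * (t ^ m / t) :=
        (hKb₂ _ _ _ _ _ _ _ ht hadm.le_side hadm'.le_side (hadm.abs_sub_le i _ (hy i))).trans
          (by gcongr; exact le_max_right _ _)
      have hF1 (l : Fin d) : |F l (y l)| ≤ K / t :=
        (hKb₁ _ _ _ _ _ ht hadm.le_side hadm.side_le (hadm.abs_sub_corner_le hδ ht l)).trans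
          (by gcongr; exact le_max_left _ _)
      have hF2 (l : Fin d) : |F' l (y l)| ≤ K / t :=
        (hKb₁ _ _ _ _ _ ht hadm'.le_side hadm'.side_le (hadm'.abs_sub_corner_le hδ ht l)).trans
          (by gcongr; exact le_max_left _ _)
      have h1 : |φ i y| ≤ K * (t ^ m / t) * ∏ _l ∈ Finset.univ.erase i, K / t := by
        change |tensorFun _ y| ≤ _
        rw [tensorFun, Finset.abs_prod, ← Finset.mul_prod_erase _ _ (Finset.mem_univ i),
          mixedFactors_self]
        gcongr with l hl
        have hl' := Finset.ne_of_mem_erase hl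
        unfold mixedFactors
        split_ifs
        · exact hF1 l
        · exact hF2 l
      refine h1.trans (le_of_eq ?_)
      have hd : d = (d - 1) + 1 := by have := i.2; omega
      rw [Finset.prod_const, Finset.card_erase_of_mem (Finset.mem_univ i), Finset.card_univ,
        Fintype.card_fin, div_pow]
      conv_rhs => rw [hd, pow_succ K, pow_succ t]
      field_simp
    · rw [hφzero i y hy, abs_zero]
      positivity
  have hφint (i : Fin d) : ∫ y, φ i y = 0 := by
    rw [hφ, integral_tensorFun]
    refine Finset.prod_eq_zero (Finset.mem_univ i) ?_
    rw [mixedFactors_self]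
    exact integral_taylorFlux hs hs' (hadm.Icc_subset i) (hadm'.Icc_subset i)
  have hmulti (i : Fin d) : multiDeriv (Pi.single i m) (φ i) =
      tensorFun (mixedFactors F F' (fun l v ↦ F' l v - F l v) i) := by
    rw [multiDeriv_single, hφ, iterate_partialDeriv_tensorFun (hfacsmooth i), mixedFactors_self, hG,
      iteratedDeriv_taylorFlux]
    exact congrArg tensorFun (update_mixedFactors F F' G (fun l v ↦ F' l v - F l v) i)
  have hmzero (i : Fin d) : ∀ y ∉ coordBox c (ρ * t), multiDeriv (Pi.single i m) (φ i) y = 0 := by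
    rw [hmulti]
    intro y hy
    refine tensorFun_eq_zero (fun l ↦ mixedFactors_induction
      (p := fun l f ↦ ∀ v ∉ Icc (c l - ρ * t) (c l + ρ * t), f v = 0)
      (fun l ↦ hadm.taylorKernel_eq_zero hδ ht m l) (fun l ↦ hadm'.taylorKernel_eq_zero hδ ht m l)
      (fun v hv ↦ ?_) l) hy
    change taylorKernel m (x i) (z' i) s' v - taylorKernel m (x i) (z i) s v = 0
    rw [hadm.taylorKernel_eq_zero hδ ht m i v hv,
      hadm'.taylorKernel_eq_zero hδ ht m i v hv, sub_zero]
  have hmcont (i : Fin d) : Continuous (multiDeriv (Pi.single i m) (φ i)) := by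
    rw [hmulti]
    refine (contDiff_tensorFun (mixedFactors_induction (p := fun _ f ↦ ContDiff ℝ ∞ f)
      (fun _ ↦ contDiff_taylorKernel ..) (fun _ ↦ contDiff_taylorKernel ..) ?_)).continuous
    exact (contDiff_taylorKernel ..).sub (contDiff_taylorKernel ..)
  have hdecomp : (∫ y in U, u y * taylorTensor m x z' s' y) - ∫ y in U, u y * taylorTensor m x z s y =
      ∑ i, ∫ y in U, u y * multiDeriv (Pi.single i m) (φ i) y := by
    simp_rw [setIntegral_eq_setIntegral_coordBox hU hQ (hmzero _)]
    rw [setIntegral_eq_setIntegral_coordBox hU hQ (hadm.taylorTensor_eq_zero hδ ht m),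
      setIntegral_eq_setIntegral_coordBox hU hQ (hadm'.taylorTensor_eq_zero hδ ht m),
      ← integral_sub (integrableOn_mul_of_coordBox hQ hu (contDiff_taylorTensor ..).continuous)
        (integrableOn_mul_of_coordBox hQ hu (contDiff_taylorTensor ..).continuous),
      ← integral_finsetSum _ fun i _ ↦ integrableOn_mul_of_coordBox hQ hu (hmcont i)]
    congr 1
    ext y
    rw [← mul_sub, ← Finset.mul_sum]
    congr 1
    rw [taylorTensor, taylorTensor, tensorFun_sub_tensorFun]
    simp_rw [hmulti]
    rfl
  rw [hdecomp]
  have hterm (i : Fin d) : |∫ y in U, u y * multiDeriv (Pi.single i m) (φ i) y| ≤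
      C * t ^ (τ - d / 2) := by
    obtain ⟨g, hg, hg2, hgs⟩ := hder i
    rw [hg.integral_eq (φ i) (hsmooth i) (hasCompactSupport_of_coordBox (hφzero i))
      ((tsupport_subset_coordBox (hφzero i)).trans hQ), abs_mul, abs_pow, abs_neg, abs_one, one_pow,
      one_mul]
    exact hCb U c t g (φ i) hU ht hQ hg.locallyIntegrableOn_right hg2 hgs (hsmooth i).continuous
      (hφzero i) (hφbd i) (hφint i)
  calc _ ≤ ∑ i, |∫ y in U, u y * multiDeriv (Pi.single i m) (φ i) y| :=
        Finset.abs_sum_le_sum_abs _ _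
    _ ≤ ∑ _i : Fin d, C * t ^ (τ - d / 2) := Finset.sum_le_sum fun i _ ↦ hterm i
    _ = d * C * t ^ (τ - d / 2) := by simp [mul_assoc]
    _ ≤ _ := by gcongr; linarith

/-- The approximation of `u x` by averages over cubes in a cone with vertex `x`. -/
lemma exists_bound_sub_pairing {τ κ A : ℝ} (hτ : (d : ℝ) / 2 < τ) (hκ : 0 < κ) (hA : 0 ≤ A) :
    ∃ ε : ℝ, 0 < ε ∧ ∃ C : ℝ, 0 < C ∧ ∀ (Ω : Set (EuclideanSpace ℝ (Fin d)))
      (u : EuclideanSpace ℝ (Fin d) → ℝ) (x ξ z : EuclideanSpace ℝ (Fin d)) (t : ℝ),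
      0 < t → ‖ξ‖ = 1 →
      (∀ t' : ℝ, 0 < t' → t' ≤ t → Metric.closedBall (x + t' • ξ) (κ * t') ⊆ Ω) →
      (∀ i, |z i - (x + t • ξ) i| ≤ ε * t) →
      ContinuousWithinAt u Ω x → LocallyIntegrableOn u (interior Ω) →
      PureDerivBound τ A (interior Ω) u →
      |u x - ∫ y in interior Ω, u y * taylorTensor ⌊τ⌋₊ x z (ε * t) y| ≤ C * t ^ (τ - d / 2) := by
  have hτ0 : 0 < τ := lt_of_le_of_lt (by positivity) hτ
  have hβ : 0 < τ - d / 2 := by linarith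
  -- The bound `1 / 2` keeps the cubes within `3 * t` of `x` in each coordinate; the other one puts
  -- the cube of half side `2 * ε * t` inside the ball of radius `κ * t` in the cone.
  set ε : ℝ := min (1 / 2) (κ / (4 * (d + 1))) with hε
  have hε0 : 0 < ε := by positivity
  have hε1 : ε ≤ 1 / 2 := min_le_left _ _
  have hεκ : d * (2 * ε) < κ := by
    have : ε ≤ κ / (4 * (d + 1)) := min_le_right _ _
    rw [le_div_iff₀ (by positivity)] at this
    have hd : (0 : ℝ) ≤ d := by positivity
    nlinarith
  -- The scale shrinks slowly: the next corner moves by at most `ε` times the current scale in each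
  -- coordinate, so two consecutive cubes share one enclosing cube. Since `q ≥ 1 / 2`, their sides
  -- stay at least `ε / 2` times that scale.
  set q : ℝ := 1 - ε with hq
  have hq0 : 0 < q := by linarith
  have hq1 : q < 1 := by linarith
  obtain ⟨C₁, hC₁, hstep⟩ := exists_bound_pairing_step (d := d) hτ0 (half_pos hε0)
    (show 0 < 2 * ε by positivity) hA
  obtain ⟨C₂, hC₂, hlim⟩ := exists_bound_pairing_sub (d := d) ⌊τ⌋₊ (half_pos hε0)
    (show 0 < 2 * ε by positivity)
  have hqβ : q ^ (τ - d / 2) < 1 := Real.rpow_lt_one hq0.le hq1 hβ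
  have hqβ' : 0 < 1 - q ^ (τ - d / 2) := by linarith
  refine ⟨ε, hε0, C₁ / (1 - q ^ (τ - d / 2)), by positivity, ?_⟩
  intro Ω u x ξ z t ht hξ hcone hz hcont hu hder
  have hξi (i : Fin d) : |ξ i| ≤ 1 := hξ ▸ PiLp.norm_apply_le ξ i
  have hT (j : ℕ) : 0 < q ^ j * t := by positivity
  have hTt (j : ℕ) : q ^ j * t ≤ t := mul_le_of_le_one_left ht.le (pow_le_one₀ hq0.le hq1.le)
  have hbox (j : ℕ) :
      coordBox (x + (q ^ j * t) • ξ) (2 * ε * (q ^ j * t)) ⊆ interior Ω := by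
    have h1 : coordBox (x + (q ^ j * t) • ξ) (2 * ε * (q ^ j * t)) ⊆
        Metric.ball (x + (q ^ j * t) • ξ) (κ * (q ^ j * t)) := by
      refine (coordBox_subset_closedBall _ (mul_nonneg (by positivity) (hT j).le)).trans
        (Metric.closedBall_subset_ball ?_)
      have := mul_lt_mul_of_pos_right hεκ (hT j)
      linarith
    refine h1.trans (interior_maximal ?_ Metric.isOpen_ball)
    exact Metric.ball_subset_closedBall.trans (hcone _ (hT j) (hTt j))
  have hadm (T s : ℝ) (w : EuclideanSpace ℝ (Fin d)) (hT0 : 0 < T) (hs : ε / 2 * T ≤ s)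
      (hs' : s ≤ ε * T) (hw : ∀ i, |w i - (x + T • ξ) i| ≤ ε * T) :
      IsAdmissibleCube (ε / 2) (2 * ε) T x (x + T • ξ) w s := by
    refine ⟨hs, hs'.trans (mul_le_of_le_one_left hT0.le (by linarith)), fun i ↦ ?_, fun i v hv ↦ ?_⟩
    · have := abs_le.1 (hw i)
      exact Icc_subset_Icc (by linarith [this.1]) (by linarith [this.2])
    · have h1 : |T * ξ i| ≤ T := by
        rw [abs_mul, abs_of_pos hT0]
        exact mul_le_of_le_one_right hT0.le (hξi i)
      have h2 : (x + T • ξ) i = x i + T * ξ i := by simp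
      rw [h2] at hv
      have h3 := abs_le.1 h1
      have h4 : ε * T ≤ 1 / 2 * T := by gcongr
      rw [abs_le]
      constructor <;> linarith [hv.1, hv.2, h3.1, h3.2]
  -- Only the initial cube has the prescribed corner `z`, later a grid point; the others follow the
  -- axis of the cone towards `x`.
  set w : ℕ → EuclideanSpace ℝ (Fin d) := fun j ↦ if j = 0 then z else x + (q ^ j * t) • ξ with hw
  have hwadm (j : ℕ) : IsAdmissibleCube (ε / 2) (2 * ε) (q ^ j * t) x (x + (q ^ j * t) • ξ) (w j)
      (ε * (q ^ j * t)) := by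
    refine hadm _ _ _ (hT j) (by nlinarith [mul_pos hε0 (hT j)]) le_rfl fun i ↦ ?_
    by_cases hj : j = 0
    · subst hj
      simpa [hw] using hz i
    · simp only [hw, if_neg hj, sub_self, abs_zero]
      exact mul_nonneg hε0.le (hT j).le
  have hwadm' (j : ℕ) : IsAdmissibleCube (ε / 2) (2 * ε) (q ^ j * t) x (x + (q ^ j * t) • ξ)
      (w (j + 1)) (ε * (q ^ (j + 1) * t)) := by
    have e1 : q ^ (j + 1) * t = (1 - ε) * (q ^ j * t) := by rw [pow_succ, hq]; ring
    have h0 := mul_pos hε0 (hT j)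
    refine hadm _ _ _ (hT j) ?_ ?_ fun i ↦ ?_
    · rw [e1]; nlinarith
    · rw [e1]; nlinarith
    · have e2 : w (j + 1) i - (x + (q ^ j * t) • ξ) i = -(ε * (q ^ j * t)) * ξ i := by
        simp only [hw, Nat.succ_ne_zero, if_false, PiLp.add_apply, PiLp.smul_apply, smul_eq_mul]
        rw [e1]; ring
      rw [e2, abs_mul, abs_neg, abs_of_pos h0]
      exact mul_le_of_le_one_right h0.le (hξi i)
  set a : ℕ → ℝ := fun j ↦
    ∫ y in interior Ω, u y * taylorTensor ⌊τ⌋₊ x (w j) (ε * (q ^ j * t)) y with ha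
  have hdist (j : ℕ) : dist (a j) (a (j + 1)) ≤
      C₁ * t ^ (τ - d / 2) * (q ^ (τ - d / 2)) ^ j := by
    rw [dist_comm, Real.dist_eq]
    refine (hstep (interior Ω) u x _ (w j) (w (j + 1)) _ _ (q ^ j * t) isOpen_interior (hT j)
      (hwadm j) (hwadm' j) (hbox j) hu hder).trans (le_of_eq ?_)
    rw [Real.mul_rpow (by positivity) ht.le, ← Real.rpow_natCast, ← Real.rpow_mul hq0.le,
      ← Real.rpow_natCast, ← Real.rpow_mul hq0.le, mul_comm (j : ℝ)]
    ring
  have htend : Filter.Tendsto a Filter.atTop (nhds (u x)) := by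
    rw [Metric.tendsto_atTop]
    intro e he
    have hcont' := Metric.continuousWithinAt_iff.1 hcont (e / (2 * C₂)) (by positivity)
    obtain ⟨η, hη, hclose⟩ := hcont'
    have hto : Filter.Tendsto (fun j : ℕ ↦ (d * 3) * (q ^ j * t)) Filter.atTop (nhds 0) := by
      have := (tendsto_pow_atTop_nhds_zero_of_lt_one hq0.le hq1).mul_const t |>.const_mul (d * 3 : ℝ)
      simpa using this
    obtain ⟨J, hJ⟩ := Filter.eventually_atTop.1 (hto.eventually (gt_mem_nhds hη))
    refine ⟨J, fun j hj ↦ ?_⟩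
    rw [Real.dist_eq]
    refine lt_of_le_of_lt (hlim (interior Ω) u x _ (w j) _ (q ^ j * t) (e / (2 * C₂)) (u x)
      isOpen_interior (hT j) (hwadm j) (hbox j) hu fun y hy ↦ ?_) ?_
    · refine (hclose (interior_subset (hbox j hy)) (lt_of_le_of_lt ?_ (hJ j hj))).le
      rw [dist_comm, dist_eq_norm]
      refine (norm_le_of_forall_abs_le (r := 3 * (q ^ j * t)) (by positivity) fun i ↦ ?_).trans
        (le_of_eq (by ring))
      exact (hwadm j).abs_sub_le i _ (hy i)
    · field_simp
      norm_num
  -- The series converges because `τ > d / 2` makes its ratio `q ^ (τ - d / 2)` smaller than one.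
  have hfin := dist_le_of_le_geometric_of_tendsto₀ _ _ hqβ hdist htend
  have ha0 : a 0 = ∫ y in interior Ω, u y * taylorTensor ⌊τ⌋₊ x z (ε * t) y := by
    simp [ha, hw]
  rw [Real.dist_eq, abs_sub_comm, ha0] at hfin
  exact hfin.trans (le_of_eq (by ring))

end LocalReproduction

/-! ### The width of the set of kernel translates -/

section Width

variable {d : ℕ}

lemma InteriorConeCondition.exists_closedBall_subset {Ω : Set (EuclideanSpace ℝ (Fin d))}
    (h : InteriorConeCondition Ω) : ∃ κ t₀ : ℝ, 0 < κ ∧ 0 < t₀ ∧ ∀ x ∈ Ω,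
      ∃ ξ : EuclideanSpace ℝ (Fin d), ‖ξ‖ = 1 ∧
        ∀ t : ℝ, 0 < t → t ≤ t₀ → Metric.closedBall (x + t • ξ) (κ * t) ⊆ Ω := by
  obtain ⟨θ, r, hθ0, hθ, hr, h⟩ := h
  set a := Real.cos θ with ha
  have ha0 : 0 < a := Real.cos_pos_of_mem_Ioo ⟨by linarith, hθ⟩
  have ha1 : a < 1 := by
    rw [ha, ← Real.cos_zero]
    exact Real.cos_lt_cos_of_nonneg_of_le_pi_div_two le_rfl hθ.le hθ0
  -- Chosen so that `1 - κ = a * (1 + κ)`: a point of the ball has axial component at least `(1 - κ)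
  -- * t` and distance at most `(1 + κ) * t` from `x`, hence lies within the angle. Since `κ ≤ 1`,
  -- the distance is at most `2 * t`, whence the radius `r / 2`.
  set κ := (1 - a) / (1 + a) with hκ
  have hκ0 : 0 < κ := div_pos (by linarith) (by linarith)
  have hκ1 : κ ≤ 1 := by rw [hκ, div_le_one (by linarith)]; linarith
  have hκ2 : 1 - κ = a * (1 + κ) := by rw [hκ]; field_simp; ring
  refine ⟨κ, r / 2, hκ0, by positivity, fun x hx ↦ ?_⟩
  obtain ⟨ξ, hξ, hcone⟩ := h x hx
  refine ⟨ξ, hξ, fun t ht htr p hp ↦ ?_⟩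
  rw [mem_closedBall_iff_norm] at hp
  set v := p - x with hv
  have hvt : ‖v - t • ξ‖ ≤ κ * t := by rwa [hv, sub_sub]
  have htξ : ‖t • ξ‖ = t := by rw [norm_smul, hξ, mul_one, Real.norm_of_nonneg ht.le]
  have hnorm : ‖v‖ ≤ (1 + κ) * t := by
    have := norm_add_le (v - t • ξ) (t • ξ)
    rw [sub_add_cancel, htξ] at this
    linarith
  have hinner : (1 - κ) * t ≤ ⟪v, ξ⟫ := by
    have h1 : ⟪v, ξ⟫ = ⟪v - t • ξ, ξ⟫ + t := by
      rw [inner_sub_left v (t • ξ), real_inner_smul_left, real_inner_self_eq_norm_sq, hξ]; ring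
    have h2 := abs_le.1 (abs_real_inner_le_norm (v - t • ξ) ξ)
    rw [hξ, mul_one] at h2
    linarith [h2.1]
  have hinner' : a * ‖v‖ ≤ ⟪v, ξ⟫ := by
    calc a * ‖v‖ ≤ a * ((1 + κ) * t) := by gcongr
      _ = (1 - κ) * t := by rw [hκ2]; ring
      _ ≤ _ := hinner
  have hp' : p = x + v := by rw [hv]; abel
  by_cases hv0 : v = 0
  · rwa [hp', hv0, add_zero]
  have hvpos : 0 < ‖v‖ := norm_pos_iff.2 hv0
  have := hcone (‖v‖⁻¹ • v) (norm_smul_inv_norm hv0)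
    (by rw [real_inner_smul_left, inv_mul_eq_div, le_div_iff₀ hvpos]; exact hinner')
    ‖v‖ hvpos.le (by nlinarith)
  rwa [smul_inv_smul₀ hvpos.ne', ← hp'] at this

/-! ### Evaluations and averages as vectors of the native space, and the approximating subspaces. -/

variable {Ω : Set (EuclideanSpace ℝ (Fin d))}
variable {H : Type*} [NormedAddCommGroup H] [InnerProductSpace ℝ H]

lemma continuousOn_extend {f : Ω → ℝ} (hf : Continuous f) :
    ContinuousOn (Function.extend Subtype.val f 0) Ω := by
  rw [continuousOn_iff_continuous_domRestrict]
  convert hf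
  ext x
  exact Subtype.val_injective.extend_apply f 0 x

lemma inner_kernelTranslate {X : Type*} [CompleteSpace H] [RKHS ℝ H X ℝ] (x : X) (f : H) :
    ⟪kernelTranslate H x, f⟫ = f x := by
  rw [kernelTranslate, RKHS.kerFun_inner]
  simp

lemma abs_apply_le {X : Type*} [CompleteSpace H] [RKHS ℝ H X ℝ] {B : ℝ}
    (hB : ∀ x, ‖kernelTranslate H x‖ ≤ B) (f : H) (x : X) : |f x| ≤ B * ‖f‖ := by
  rw [← inner_kernelTranslate]
  exact (abs_real_inner_le_norm _ _).trans (by gcongr; exact hB x)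

/-- Point evaluations are uniformly bounded on `H`, so integration against `φ` is a bounded
functional and Riesz representation applies. -/
lemma exists_representer [CompleteSpace H] [RKHS ℝ H Ω ℝ] {B : ℝ}
    (hB : ∀ x, ‖kernelTranslate H x‖ ≤ B) (hcont : ∀ f : H, Continuous f)
    {φ : EuclideanSpace ℝ (Fin d) → ℝ} (hφ : Continuous φ) (hφc : HasCompactSupport φ) :
    ∃ w : H, ∀ f : H,
      ⟪w, f⟫ = ∫ y in interior Ω, Function.extend Subtype.val f 0 y * φ y := by
  have hφi : Integrable φ (volume.restrict (interior Ω)) :=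
    (hφ.integrable_of_hasCompactSupport hφc).restrict
  have hbd (f : H) : ∀ᵐ y ∂volume.restrict (interior Ω),
      ‖Function.extend Subtype.val f 0 y‖ ≤ B * ‖f‖ := by
    refine (ae_restrict_iff' isOpen_interior.measurableSet).2 (Filter.Eventually.of_forall ?_)
    intro y hy
    rw [show y = ((⟨y, interior_subset hy⟩ : Ω) : EuclideanSpace ℝ (Fin d)) from rfl,
      Subtype.val_injective.extend_apply]
    exact abs_apply_le hB f _
  have hint (f : H) : IntegrableOn (fun y ↦ Function.extend Subtype.val f 0 y * φ y)
      (interior Ω) :=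
    hφi.bdd_mul (((continuousOn_extend (hcont f)).mono interior_subset).aestronglyMeasurable
      isOpen_interior.measurableSet) (hbd f)
  have hcongr {p q : EuclideanSpace ℝ (Fin d) → ℝ}
      (h : ∀ y : Ω, p y = q y) : ∫ y in interior Ω, p y = ∫ y in interior Ω, q y :=
    setIntegral_congr_fun isOpen_interior.measurableSet fun y hy ↦ h ⟨y, interior_subset hy⟩
  let Λ : H →ₗ[ℝ] ℝ :=
    { toFun := fun f ↦ ∫ y in interior Ω, Function.extend Subtype.val f 0 y * φ y
      map_add' := fun f g ↦ by
        rw [← integral_add (hint f) (hint g)]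
        refine hcongr fun y ↦ ?_
        simp only [Subtype.val_injective.extend_apply, RKHS.coe_add, Pi.add_apply, add_mul]
      map_smul' := fun c f ↦ by
        rw [RingHom.id_apply, smul_eq_mul, ← integral_const_mul]
        refine hcongr fun y ↦ ?_
        simp only [Subtype.val_injective.extend_apply, RKHS.coe_smul, Pi.smul_apply, smul_eq_mul,
          mul_assoc] }
  have hΛ (f : H) : ‖Λ f‖ ≤ (B * ∫ y in interior Ω, ‖φ y‖) * ‖f‖ := by
    refine (norm_integral_le_of_norm_le (hφi.norm.const_mul (B * ‖f‖)) ?_).trans (le_of_eq ?_)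
    · filter_upwards [hbd f] with y hy
      rw [norm_mul]
      gcongr
    · rw [integral_const_mul]; ring
  refine ⟨(InnerProductSpace.toDual ℝ H).symm (Λ.mkContinuous _ hΛ), fun f ↦ ?_⟩
  rw [InnerProductSpace.toDual_symm_apply]
  rfl

/-- A point of the uniform grid with spacing `h` in the cube with lower corner `-R`. -/
def gridPoint {L : ℕ} (R h : ℝ) (k : Fin d → Fin L) : EuclideanSpace ℝ (Fin d) :=
  WithLp.toLp 2 fun i ↦ -R + h * (k i : ℕ)

lemma exists_gridPoint {L : ℕ} (hL : 0 < L) {R h : ℝ} (hh : 0 < h) (hRh : 2 * R ≤ h * L)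
    {c : EuclideanSpace ℝ (Fin d)} (hc : ∀ i, |c i| ≤ R) :
    ∃ k : Fin d → Fin L, ∀ i, |gridPoint R h k i - c i| ≤ h := by
  have : ∀ i, ∃ k : Fin L, |-R + h * (k : ℕ) - c i| ≤ h := fun i ↦ by
    have hci := abs_le.1 (hc i)
    have h0 : 0 ≤ (c i + R) / h := div_nonneg (by linarith [hci.1]) hh.le
    have hfl := Nat.floor_le h0
    have hfl' := Nat.lt_floor_add_one ((c i + R) / h)
    rw [le_div_iff₀ hh] at hfl
    rw [div_lt_iff₀ hh] at hfl'
    by_cases hlt : ⌊(c i + R) / h⌋₊ < L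
    · refine ⟨⟨_, hlt⟩, ?_⟩
      rw [abs_le]
      constructor <;> simp only <;> nlinarith
    · push Not at hlt
      refine ⟨⟨L - 1, by omega⟩, ?_⟩
      have h1 : ((L - 1 : ℕ) : ℝ) = L - 1 := by
        rw [Nat.cast_sub (by omega)]; simp
      have h2 : (L : ℝ) * h ≤ c i + R := le_trans (by gcongr) hfl
      simp only [h1]
      rw [abs_le]
      constructor <;> linarith [hci.2]
  choose k hk using this
  exact ⟨k, hk⟩

/-- The profiles of the tensor products of averaged Taylor kernels, scaled to the cube with
corner `z` and side `s`. -/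
def profileTensor (m : ℕ) (z : EuclideanSpace ℝ (Fin d)) (s : ℝ) (j : Fin d → Fin (m + 1)) :
    EuclideanSpace ℝ (Fin d) → ℝ :=
  tensorFun fun i v ↦ taylorProfile m (j i) ((v - z i) / s)

lemma continuous_profileTensor (m : ℕ) (z : EuclideanSpace ℝ (Fin d)) (s : ℝ)
    (j : Fin d → Fin (m + 1)) : Continuous (profileTensor m z s j) :=
  (contDiff_tensorFun fun _ ↦ (contDiff_taylorProfile ..).comp (by fun_prop)).continuous

lemma hasCompactSupport_profileTensor (m : ℕ) (z : EuclideanSpace ℝ (Fin d)) {s : ℝ} (hs : 0 < s)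
    (j : Fin d → Fin (m + 1)) : HasCompactSupport (profileTensor m z s j) := by
  refine hasCompactSupport_of_coordBox (c := z) (r := s) fun y hy ↦
    tensorFun_eq_zero (fun i v hv ↦ ?_) hy
  refine taylorProfile_eq_zero (by omega) fun h ↦ hv ?_
  rw [mem_Icc, le_div_iff₀ hs, div_le_iff₀ hs] at h
  constructor <;> linarith [h.1, h.2]

lemma taylorTensor_eq_sum (m : ℕ) (x z : EuclideanSpace ℝ (Fin d)) {s : ℝ} (hs : 0 < s) :
    ∃ b : (Fin d → Fin (m + 1)) → ℝ, ∀ y, taylorTensor m x z s y =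
      ∑ j, b j * profileTensor m z s j y := by
  refine ⟨fun j ↦ ∏ i, taylorCoeff m (j i) (x i) (z i) s, fun y ↦ ?_⟩
  simp only [taylorTensor, tensorFun, profileTensor, taylorKernel_eq_sum hs, Finset.sum_range]
  rw [Fintype.prod_sum]
  simp_rw [Finset.prod_mul_distrib]

theorem exists_subspace_approximating_kernelTranslate {τ B : ℝ} (hΩ : IsCompact Ω)
    (hcone : InteriorConeCondition Ω) [CompleteSpace H] [RKHS ℝ H Ω ℝ]
    (hτ : (d : ℝ) / 2 < τ) (hsmooth : HasFiniteSmoothness H τ)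
    (hB : ∀ x, ‖kernelTranslate H x‖ ≤ B) :
    ∃ C : ℝ, 0 < C ∧ ∀ L : ℕ, 0 < L → ∃ W : Submodule ℝ H, FiniteDimensional ℝ W ∧
      Module.finrank ℝ W ≤ (L * (⌊τ⌋₊ + 1)) ^ d ∧
        ∀ x, ∃ w ∈ W, ‖kernelTranslate H x - w‖ ≤ C * (L : ℝ) ^ (-(τ - d / 2)) := by
  have hβ : 0 < τ - d / 2 := by linarith
  obtain ⟨hiff, _, Cs, -, hCs, hnorm⟩ := hsmooth
  have hcont (f : H) : Continuous f := ((hiff f).1 ⟨f, rfl⟩).1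
  obtain ⟨κ, t₀, hκ, ht₀, hball⟩ := hcone.exists_closedBall_subset
  obtain ⟨ε, hε, C₁, hC₁, happrox⟩ := exists_bound_sub_pairing (d := d) hτ hκ
    (sq_nonneg (2 * Cs))
  obtain ⟨R, hR⟩ := hΩ.isBounded.exists_norm_le
  set R' := max R 1 with hR'
  have hR'0 : 0 < R' := lt_of_lt_of_le one_pos (le_max_right _ _)
  -- With this scale the side `ε * t L` equals `2 * R' / L`, the spacing of a grid of `L ^ d` points
  -- for a cube containing `Ω`.
  set t : ℕ → ℝ := fun L ↦ 2 * R' / (ε * L) with ht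
  set L₀ : ℝ := 2 * R' / (ε * t₀) with hL₀
  have hL₀pos : 0 < L₀ := by positivity
  refine ⟨C₁ * (2 * R' / ε) ^ (τ - d / 2) + |B| * L₀ ^ (τ - d / 2), by positivity, ?_⟩
  intro L hL
  have hLr : (0 : ℝ) < L := by exact_mod_cast hL
  by_cases hLL : L₀ ≤ L
  · have htpos : 0 < t L := by positivity
    have htt₀ : t L ≤ t₀ := by
      rw [ht]
      rw [hL₀, div_le_iff₀ (by positivity)] at hLL
      rw [div_le_iff₀ (by positivity)]
      linarith
    have hstep : 0 < ε * t L := by positivity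
    have hrep : ∀ p : (Fin d → Fin L) × (Fin d → Fin (⌊τ⌋₊ + 1)), ∃ w : H, ∀ f : H, ⟪w, f⟫ =
        ∫ y in interior Ω, Function.extend Subtype.val f 0 y *
          profileTensor ⌊τ⌋₊ (gridPoint R' (ε * t L) p.1) (ε * t L) p.2 y := fun p ↦
      exists_representer hB hcont (continuous_profileTensor ..)
        (hasCompactSupport_profileTensor _ _ hstep _)
    choose w hw using hrep
    refine ⟨Submodule.span ℝ (range w), FiniteDimensional.span_of_finite ℝ (finite_range w), ?_, ?_⟩
    · refine (finrank_range_le_card w).trans (le_of_eq ?_)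
      simp [mul_pow]
    · have : FiniteDimensional ℝ (Submodule.span ℝ (range w)) :=
        FiniteDimensional.span_of_finite ℝ (finite_range w)
      -- If `f` is orthogonal to all representers, its Taylor average over the grid cube near `x + t
      -- ξ` vanishes, and `f x` is reduced to the approximation error.
      have key (f : H) (hf1 : ‖f‖ = 1) (hf : ∀ p, ⟪w p, f⟫ = 0) (x : Ω) :
          |f x| ≤ C₁ * (t L) ^ (τ - d / 2) := by
        obtain ⟨ξ, hξ, hξball⟩ := hball x x.2
        set c := (x : EuclideanSpace ℝ (Fin d)) + t L • ξ with hc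
        have hcΩ : c ∈ Ω := hξball (t L) htpos htt₀
          (Metric.mem_closedBall_self (by positivity))
        have hci (i : Fin d) : |c i| ≤ R' :=
          (PiLp.norm_apply_le c i).trans ((hR c hcΩ).trans (le_max_left _ _))
        obtain ⟨k, hk⟩ := exists_gridPoint hL hstep
          (le_of_eq (by rw [ht]; field_simp)) hci
        have hder : PureDerivBound τ ((2 * Cs) ^ 2) (interior Ω)
            (Function.extend Subtype.val f 0) := by
          refine pureDerivBound_of_sobolevNorm_lt (by positivity) ?_
          refine lt_of_le_of_lt (hnorm f).2 ?_
          rw [hf1, mul_one]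
          exact (ENNReal.ofReal_lt_ofReal_iff (by positivity)).2 (by linarith)
        have hcontΩ := continuousOn_extend (hcont f)
        have h := happrox Ω (Function.extend Subtype.val f 0) x ξ (gridPoint R' (ε * t L) k) (t L)
          htpos hξ (fun t' ht' htt' ↦ hξball t' ht' (htt'.trans htt₀)) hk (hcontΩ x x.2)
          ((hcontΩ.mono interior_subset).locallyIntegrableOn isOpen_interior.measurableSet) hder
        obtain ⟨b, hb⟩ := taylorTensor_eq_sum ⌊τ⌋₊ x (gridPoint R' (ε * t L) k) hstep
        have hzero : ∫ y in interior Ω, Function.extend Subtype.val f 0 y *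
            taylorTensor ⌊τ⌋₊ x (gridPoint R' (ε * t L) k) (ε * t L) y = 0 := by
          simp_rw [hb, Finset.mul_sum]
          have hcb : ∀ y ∈ interior Ω, ‖Function.extend Subtype.val f 0 y‖ ≤ B * ‖f‖ := by
            intro y hy
            rw [show y = ((⟨y, interior_subset hy⟩ : Ω) : EuclideanSpace ℝ (Fin d)) from rfl,
              Subtype.val_injective.extend_apply]
            exact abs_apply_le hB f _
          rw [integral_finsetSum]
          · refine Finset.sum_eq_zero fun j _ ↦ ?_
            have : ∀ y, Function.extend Subtype.val f 0 y *
                (b j * profileTensor ⌊τ⌋₊ (gridPoint R' (ε * t L) k) (ε * t L) j y) =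
                b j * (Function.extend Subtype.val f 0 y *
                  profileTensor ⌊τ⌋₊ (gridPoint R' (ε * t L) k) (ε * t L) j y) := fun y ↦ by ring
            simp_rw [this]
            rw [integral_const_mul, ← hw (k, j), hf, mul_zero]
          · intro j _
            refine Integrable.bdd_mul (c := B * ‖f‖) ?_ ((hcontΩ.mono
              interior_subset).aestronglyMeasurable isOpen_interior.measurableSet) ?_
            · exact (((continuous_profileTensor ..).integrable_of_hasCompactSupport
                (hasCompactSupport_profileTensor _ _ hstep _)).const_mul _).restrict
            · exact (ae_restrict_iff' isOpen_interior.measurableSet).2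
                (Filter.Eventually.of_forall hcb)
        rw [hzero, sub_zero, Subtype.val_injective.extend_apply] at h
        exact h
      intro x
      set P := (Submodule.span ℝ (range w)).starProjection with hP
      refine ⟨P (kernelTranslate H x), Submodule.starProjection_apply_mem _ _, ?_⟩
      set f := kernelTranslate H x - P (kernelTranslate H x) with hf
      have horth : ∀ v ∈ Submodule.span ℝ (range w), ⟪v, f⟫ = 0 := fun v hv ↦
        (Submodule.mem_orthogonal _ _).1 (Submodule.sub_starProjection_mem_orthogonal _) v hv
      have ht_eq : t L ^ (τ - d / 2) = (2 * R' / ε) ^ (τ - d / 2) * (L : ℝ) ^ (-(τ - d / 2)) := by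
        rw [ht, Real.rpow_neg hLr.le, ← div_eq_mul_inv, ← Real.div_rpow (by positivity) hLr.le,
          div_div]
      have hle : ‖f‖ ≤ C₁ * (t L) ^ (τ - d / 2) := by
        by_cases hf0 : f = 0
        · rw [hf0, norm_zero]; positivity
        have hfpos : 0 < ‖f‖ := norm_pos_iff.2 hf0
        -- Duality: the normalized projection error takes at `x` the value `‖f‖`.
        have h1 := key (‖f‖⁻¹ • f) (norm_smul_inv_norm hf0) (fun p ↦ by
          rw [real_inner_smul_right, horth _ (Submodule.subset_span (mem_range_self p)),
            mul_zero]) x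
        rw [RKHS.coe_smul, Pi.smul_apply, smul_eq_mul, ← inner_kernelTranslate,
          show kernelTranslate H x = f + P (kernelTranslate H x) by rw [hf]; abel, inner_add_left,
          horth _ (Submodule.starProjection_apply_mem _ _), add_zero,
          real_inner_self_eq_norm_sq, sq, inv_mul_cancel_left₀ hfpos.ne', abs_of_pos hfpos] at h1
        exact h1
      refine hle.trans ?_
      rw [ht_eq, add_mul, ← mul_assoc]
      have : 0 ≤ |B| * L₀ ^ (τ - d / 2) * (L : ℝ) ^ (-(τ - d / 2)) := by positivity
      linarith
  -- For small `L` the scale would exceed the height of the cones; the zero subspace suffices, since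
  -- `L₀ / L > 1` absorbs the trivial bound.
  · push Not at hLL
    refine ⟨⊥, inferInstance, by simp, fun x ↦ ⟨0, Submodule.zero_mem _, ?_⟩⟩
    rw [sub_zero]
    have h1 : 1 ≤ L₀ ^ (τ - d / 2) * (L : ℝ) ^ (-(τ - d / 2)) := by
      rw [Real.rpow_neg hLr.le, ← div_eq_mul_inv, ← Real.div_rpow hL₀pos.le hLr.le]
      exact Real.one_le_rpow ((one_le_div hLr).2 hLL.le) hβ.le
    calc ‖kernelTranslate H x‖ ≤ |B| * 1 := by rw [mul_one]; exact (hB x).trans (le_abs_self B)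
      _ ≤ |B| * (L₀ ^ (τ - d / 2) * (L : ℝ) ^ (-(τ - d / 2))) := by gcongr
      _ ≤ _ := by
        rw [add_mul, ← mul_assoc]
        have : 0 ≤ C₁ * (2 * R' / ε) ^ (τ - d / 2) * (L : ℝ) ^ (-(τ - d / 2)) := by positivity
        linarith

end Width

/-! ### Power functions and greedy selection -/

section Determinant

lemma det_smul_starProjection_add {E : Type*} [NormedAddCommGroup E] [InnerProductSpace ℝ E]
    [FiniteDimensional ℝ E] (W : Submodule ℝ E) (a b : ℝ) :
    LinearMap.det (a • (W.starProjection : E →ₗ[ℝ] E) +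
      b • (Wᗮ.starProjection : E →ₗ[ℝ] E)) =
        a ^ Module.finrank ℝ W * b ^ Module.finrank ℝ Wᗮ := by
  let e := Submodule.prodEquivOfIsCompl W Wᗮ W.isCompl_orthogonal
  have h : a • (W.starProjection : E →ₗ[ℝ] E) + b • (Wᗮ.starProjection : E →ₗ[ℝ] E) =
      e.toLinearMap ∘ₗ (LinearMap.prodMap (a • LinearMap.id) (b • LinearMap.id)) ∘ₗ
        e.symm.toLinearMap := by
    rw [← LinearMap.comp_assoc, LinearEquiv.eq_comp_toLinearMap_symm]
    ext ⟨v, hv⟩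
    · have h1 : W.starProjection v = v := Submodule.starProjection_eq_self_iff.2 hv
      have h2 : Wᗮ.starProjection v = 0 := by
        rw [Submodule.starProjection_orthogonal_val, h1, sub_self]
      simp [e, h1, h2]
    · have h2 : Wᗮ.starProjection v = v := Submodule.starProjection_eq_self_iff.2 hv
      have h1 : W.starProjection v = 0 := by
        rw [Submodule.starProjection_orthogonal_val] at h2
        exact sub_eq_self.1 h2
      simp [e, h1, h2]
  rw [h, LinearMap.det_conj, LinearMap.det_prodMap]
  simp [LinearMap.det_smul]

/-- Hadamard's inequality. -/
lemma abs_det_basisFun_le {K : ℕ} (c : Fin K → EuclideanSpace ℝ (Fin K)) :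
    |(EuclideanSpace.basisFun (Fin K) ℝ).toBasis.det c| ≤ ∏ i, ‖c i‖ := by
  have : Fact (Module.finrank ℝ (EuclideanSpace ℝ (Fin K)) = K) := ⟨by simp⟩
  rw [← Orientation.volumeForm_robust _ (EuclideanSpace.basisFun (Fin K) ℝ) rfl]
  exact Orientation.abs_volumeForm_apply_le _ c

variable {H : Type*} [NormedAddCommGroup H] [InnerProductSpace ℝ H]

/-- The determinant of the triangular coordinate matrix is the product of its diagonal entries. The
coordinate vectors are long only along a subspace of dimension at most `K / 2`; compressing that
subspace and stretching its complement does not decrease the determinant, while it shortens every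
vector to at most `√(2 * s * δ)`. Hadamard's inequality then bounds the product. -/
lemma exists_abs_diag_le_of_approx {K : ℕ} (hK : 0 < K) {e v : Fin K → H} (he : Orthonormal ℝ e)
    (htri : ∀ i j, i < j → ⟪e j, v i⟫ = 0) {s δ : ℝ} (hδ : 0 < δ) (hδs : δ ≤ s)
    (hs : ∀ i, ∑ j, ⟪e j, v i⟫ ^ 2 ≤ s ^ 2) (W : Submodule ℝ H) [FiniteDimensional ℝ W]
    (hW : 2 * Module.finrank ℝ W ≤ K) (hvW : ∀ i, ∃ w ∈ W, ‖v i - w‖ ≤ δ) :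
    ∃ i, |⟪e i, v i⟫| ≤ √(2 * s * δ) := by
  have hs0 : 0 < s := hδ.trans_le hδs
  let T : H →ₗ[ℝ] EuclideanSpace ℝ (Fin K) :=
    (WithLp.linearEquiv 2 ℝ (Fin K → ℝ)).symm.toLinearMap ∘ₗ
      LinearMap.pi fun j ↦ (innerₛₗ ℝ (e j))
  have hT (h : H) (j : Fin K) : T h j = ⟪e j, h⟫ := rfl
  have hTnorm (h : H) : ‖T h‖ ^ 2 = ∑ j, ⟪e j, h⟫ ^ 2 := by
    rw [EuclideanSpace.norm_sq_eq]
    simp only [hT, Real.norm_eq_abs, sq_abs]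
  have hTle (h : H) : ‖T h‖ ≤ ‖h‖ := by
    refine abs_le_of_sq_le_sq' ?_ (norm_nonneg h) |>.2
    rw [hTnorm]
    have := he.sum_inner_products_le (x := h) (s := Finset.univ)
    simpa only [Real.norm_eq_abs, sq_abs] using this
  set W' := W.map T with hW'
  have hrank : Module.finrank ℝ W' ≤ Module.finrank ℝ W := Submodule.finrank_map_le T W
  set P := W'.starProjection with hP
  -- This factor equalizes the two contributions: `l * s` and `l⁻¹ * δ` both equal `√(s * δ)`.
  set l : ℝ := √(δ / s) with hl
  have hl0 : 0 < l := Real.sqrt_pos.2 (div_pos hδ hs0)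
  have hl2 : l ^ 2 = δ / s := Real.sq_sqrt (div_pos hδ hs0).le
  have hl1 : l ≤ 1 := Real.sqrt_le_one.2 ((div_le_one hs0).2 hδs)
  set S : EuclideanSpace ℝ (Fin K) →ₗ[ℝ] EuclideanSpace ℝ (Fin K) :=
    l • (W'.starProjection : EuclideanSpace ℝ (Fin K) →ₗ[ℝ] EuclideanSpace ℝ (Fin K)) +
      l⁻¹ • (W'ᗮ.starProjection : EuclideanSpace ℝ (Fin K) →ₗ[ℝ] EuclideanSpace ℝ (Fin K)) with hS
  have hdet : 1 ≤ LinearMap.det S := by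
    have hsum := W'.finrank_add_finrank_orthogonal
    rw [finrank_euclideanSpace_fin] at hsum
    have hle : Module.finrank ℝ W' ≤ Module.finrank ℝ W'ᗮ := by omega
    rw [hS, det_smul_starProjection_add, inv_pow, ← div_eq_mul_inv, one_le_div (by positivity)]
    exact pow_le_pow_of_le_one hl0.le hl1 hle
  set c : Fin K → EuclideanSpace ℝ (Fin K) := fun i ↦ T (v i) with hc
  have hcs (i : Fin K) : ‖c i‖ ≤ s := by
    refine abs_le_of_sq_le_sq' ?_ hs0.le |>.2
    rw [hc, hTnorm]
    exact hs i
  have hSc (i : Fin K) : ‖S (c i)‖ ≤ √(2 * s * δ) := by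
    have h1 : ‖W'.starProjection (c i)‖ ≤ s := (W'.norm_starProjection_apply_le _).trans (hcs i)
    have h2 : ‖W'ᗮ.starProjection (c i)‖ ≤ δ := by
      obtain ⟨w, hw, hwδ⟩ := hvW i
      have hTw : T w ∈ W' := Submodule.mem_map_of_mem hw
      have : W'ᗮ.starProjection (c i) = W'ᗮ.starProjection (c i - T w) := by
        rw [map_sub, Submodule.starProjection_orthogonal_val (K := W') (u := T w),
          Submodule.starProjection_eq_self_iff.2 hTw, sub_self, sub_zero]
      rw [this]
      refine (W'ᗮ.norm_starProjection_apply_le _).trans (le_trans ?_ hwδ)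
      rw [hc, ← map_sub]
      exact hTle _
    have horth : ⟪l • W'.starProjection (c i), l⁻¹ • W'ᗮ.starProjection (c i)⟫ = 0 := by
      rw [real_inner_smul_left, real_inner_smul_right,
        Submodule.inner_right_of_mem_orthogonal (Submodule.starProjection_apply_mem W' _)
          (Submodule.starProjection_apply_mem W'ᗮ _)]
      simp
    have h3 : ‖S (c i)‖ ^ 2 =
        ‖l • W'.starProjection (c i)‖ ^ 2 + ‖l⁻¹ • W'ᗮ.starProjection (c i)‖ ^ 2 := by
      rw [sq, sq, sq, ← norm_add_sq_eq_norm_sq_add_norm_sq_real horth]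
      rfl
    refine Real.le_sqrt_of_sq_le ?_
    rw [h3, norm_smul, norm_smul, mul_pow, mul_pow, Real.norm_of_nonneg hl0.le,
      Real.norm_of_nonneg (inv_nonneg.2 hl0.le), inv_pow, hl2]
    calc δ / s * ‖W'.starProjection (c i)‖ ^ 2 + (δ / s)⁻¹ * ‖W'ᗮ.starProjection (c i)‖ ^ 2
        ≤ δ / s * s ^ 2 + (δ / s)⁻¹ * δ ^ 2 := by gcongr
      _ = 2 * s * δ := by field_simp; ring
  have hprod : ∏ i, |⟪e i, v i⟫| ≤ ∏ _i : Fin K, √(2 * s * δ) := by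
    set b := (EuclideanSpace.basisFun (Fin K) ℝ).toBasis with hb
    have h1 : b.det c = ∏ i, ⟪e i, v i⟫ := by
      rw [Module.Basis.det_apply, Matrix.det_of_isUpperTriangular]
      · rfl
      · exact fun i j hij ↦ htri j i hij
    rw [← Finset.abs_prod, ← h1]
    have h2 : b.det (S ∘ c) = LinearMap.det S * b.det c := b.det_comp S c
    calc |b.det c| ≤ LinearMap.det S * |b.det c| := le_mul_of_one_le_left (abs_nonneg _) hdet
      _ = |b.det (S ∘ c)| := by rw [h2, abs_mul, abs_of_pos (by linarith : 0 < LinearMap.det S)]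
      _ ≤ ∏ i, ‖S (c i)‖ := abs_det_basisFun_le _
      _ ≤ _ := Finset.prod_le_prod (fun _ _ ↦ norm_nonneg _) fun i _ ↦ hSc i
  by_contra hcon
  push Not at hcon
  have : Nonempty (Fin K) := ⟨⟨0, hK⟩⟩
  refine absurd hprod (not_le.2 (Finset.prod_lt_prod_of_nonempty (fun i _ ↦ ?_)
    (fun i _ ↦ hcon i) Finset.univ_nonempty))
  exact Real.sqrt_pos.2 (by positivity)

end Determinant

/-! ### The Power function as the norm of a projection residual, and its decay over a block of
greedy steps. -/

section PowerFunction

variable {X : Type*} {H : Type*} [NormedAddCommGroup H] [InnerProductSpace ℝ H] [CompleteSpace H]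
  [RKHS ℝ H X ℝ]

lemma kernelTranslate_mem_kernelSpan {s : Finset X} {x : X} (hx : x ∈ s) :
    kernelTranslate H x ∈ kernelSpan H s :=
  Submodule.subset_span ⟨x, hx, rfl⟩

lemma kernelSpan_mono {s t : Finset X} (h : s ⊆ t) : kernelSpan H s ≤ kernelSpan H t :=
  Submodule.span_mono (image_mono (by exact_mod_cast h))

variable (H) in
/-- The error of the best approximation of the kernel translate at `x` from `V(s)`. -/
def kernelResidual (s : Finset X) (x : X) : H :=
  kernelTranslate H x - (kernelSpan H s).starProjection (kernelTranslate H x)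

lemma inner_kernelResidual_of_mem {s : Finset X} {x : X} {v : H} (hv : v ∈ kernelSpan H s) :
    ⟪kernelResidual H s x, v⟫ = 0 :=
  Submodule.inner_left_of_mem_orthogonal hv (Submodule.sub_starProjection_mem_orthogonal _)

lemma inner_kernelResidual_self (s : Finset X) (x : X) :
    ⟪kernelResidual H s x, kernelTranslate H x⟫ = ‖kernelResidual H s x‖ ^ 2 := by
  rw [← real_inner_self_eq_norm_sq]
  conv_rhs => rw [kernelResidual, inner_sub_right]
  rw [← kernelResidual, inner_kernelResidual_of_mem (Submodule.starProjection_apply_mem _ _),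
    sub_zero]

lemma kernelResidual_mem {s t : Finset X} {x : X} (h : s ⊆ t) (hx : x ∈ t) :
    kernelResidual H s x ∈ kernelSpan H t :=
  Submodule.sub_mem _ (kernelTranslate_mem_kernelSpan hx)
    (kernelSpan_mono h (Submodule.starProjection_apply_mem _ _))

lemma apply_sub_interpolant_apply (s : Finset X) (f : H) (x : X) :
    f x - interpolant H s f x = ⟪kernelResidual H s x, f⟫ := by
  rw [kernelResidual, inner_sub_left, inner_kernelTranslate,
    Submodule.inner_starProjection_left_eq_right, inner_kernelTranslate]
  rfl

lemma abs_sub_interpolant_div_le (s : Finset X) (f : H) (x : X) :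
    |f x - interpolant H s f x| / ‖f‖ ≤ ‖kernelResidual H s x‖ := by
  rw [apply_sub_interpolant_apply]
  exact div_le_of_le_mul₀ (norm_nonneg _) (norm_nonneg _) (abs_real_inner_le_norm _ _)

/-- The pointwise error functional is represented by the residual, and the residual itself attains
the supremum when it is nonzero. -/
lemma powerFunction_eq_norm_kernelResidual (s : Finset X) (x : X) :
    powerFunction H s x = ‖kernelResidual H s x‖ := by
  refine le_antisymm (Real.iSup_le (fun f ↦ abs_sub_interpolant_div_le s f.1 x) (norm_nonneg _)) ?_
  by_cases h0 : kernelResidual H s x = 0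
  · rw [h0, norm_zero]
    exact Real.iSup_nonneg fun f ↦ by positivity
  · have hbdd : BddAbove (range fun f : {f : H // f ≠ 0} ↦
        |f.1 x - interpolant H s f.1 x| / ‖f.1‖) :=
      ⟨_, forall_mem_range.2 fun f ↦ abs_sub_interpolant_div_le s f.1 x⟩
    refine le_trans (le_of_eq ?_) (le_ciSup hbdd ⟨_, h0⟩)
    simp only
    rw [apply_sub_interpolant_apply, real_inner_self_eq_norm_sq, abs_of_nonneg (sq_nonneg _), sq,
      mul_self_div_self]

lemma powerFunction_nonneg (s : Finset X) (x : X) : 0 ≤ powerFunction H s x := by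
  rw [powerFunction_eq_norm_kernelResidual]
  exact norm_nonneg _

lemma abs_sub_interpolant_le (s : Finset X) (f : H) (x : X) :
    |f x - interpolant H s f x| ≤ powerFunction H s x * ‖f‖ := by
  rw [powerFunction_eq_norm_kernelResidual, apply_sub_interpolant_apply]
  exact abs_real_inner_le_norm _ _

lemma powerFunction_anti {s t : Finset X} (h : s ⊆ t) (x : X) :
    powerFunction H t x ≤ powerFunction H s x := by
  rw [powerFunction_eq_norm_kernelResidual, powerFunction_eq_norm_kernelResidual]
  have : kernelResidual H t x = (kernelSpan H t)ᗮ.starProjection (kernelResidual H s x) := by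
    have hmem := kernelSpan_mono (H := H) h
      (Submodule.starProjection_apply_mem (kernelSpan H s) (kernelTranslate H x))
    rw [Submodule.starProjection_orthogonal_val, kernelResidual, kernelResidual, map_sub,
      Submodule.starProjection_eq_self_iff.2 hmem]
    abel
  rw [this]
  exact Submodule.norm_starProjection_apply_le _ _

lemma powerFunction_le_norm (s : Finset X) (x : X) :
    powerFunction H s x ≤ ‖kernelTranslate H x‖ := by
  rw [powerFunction_eq_norm_kernelResidual, kernelResidual,
    ← Submodule.starProjection_orthogonal_val]
  exact Submodule.norm_starProjection_apply_le _ _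

lemma supNorm_le_ofReal {g : X → ℝ} {a : ℝ} (h : ∀ x, |g x| ≤ a) :
    supNorm g ≤ ENNReal.ofReal a :=
  iSup_le fun x ↦ by
    rw [Real.enorm_eq_ofReal_abs]
    exact ENNReal.ofReal_le_ofReal (h x)

lemma mul_powerFunction_le_of_mem_restrictedSet {γ : ℝ} (hγ : 0 ≤ γ) {s : Finset X} {x : X}
    (hx : x ∈ restrictedSet H γ s) (y : X) :
    γ * powerFunction H s y ≤ powerFunction H s x := by
  have h : ENNReal.ofReal γ * ‖powerFunction H s y‖ₑ ≤ ‖powerFunction H s x‖ₑ :=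
    le_trans (mul_le_mul_right (le_iSup (fun y ↦ ‖powerFunction H s y‖ₑ) y) _) hx
  rw [Real.enorm_eq_ofReal (powerFunction_nonneg s y),
    Real.enorm_eq_ofReal (powerFunction_nonneg s x), ← ENNReal.ofReal_mul hγ] at h
  exact (ENNReal.ofReal_le_ofReal_iff (powerFunction_nonneg s x)).1 h

lemma firstPoints_mono (x : ℕ → X) {m n : ℕ} (h : m ≤ n) : firstPoints x m ⊆ firstPoints x n := by
  classical
  unfold firstPoints
  exact Finset.image_subset_image (Finset.range_mono h)

lemma mem_firstPoints (x : ℕ → X) {m n : ℕ} (h : m < n) : x m ∈ firstPoints x n := by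
  classical
  unfold firstPoints
  exact Finset.mem_image_of_mem x (Finset.mem_range.2 h)

/-- Among `K` consecutive points of any sequence, one has small Power function value. -/
lemma exists_powerFunction_le_of_approx (x : ℕ → X) (N : ℕ) {K : ℕ} (hK : 0 < K) {s δ : ℝ}
    (hδ : 0 < δ) (hδs : δ ≤ s) (hs : ∀ y, powerFunction H (firstPoints x N) y ≤ s)
    (W : Submodule ℝ H) [FiniteDimensional ℝ W] (hW : 2 * Module.finrank ℝ W ≤ K)
    (hWδ : ∀ y, ∃ w ∈ W, ‖kernelTranslate H y - w‖ ≤ δ) :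
    ∃ i < K, powerFunction H (firstPoints x (N + i)) (x (N + i)) ≤ √(2 * s * δ) := by
  by_contra hcon
  push Not at hcon
  -- Gram–Schmidt residuals of the successive translates. The assumption for contradiction makes
  -- them nonzero, even if points were repeated, so they can be normalized.
  set r : Fin K → H := fun i ↦ kernelResidual H (firstPoints x (N + i)) (x (N + i)) with hr
  have hrnorm (i : Fin K) : √(2 * s * δ) < ‖r i‖ := by
    rw [hr, ← powerFunction_eq_norm_kernelResidual]
    exact hcon i i.2
  have hrpos (i : Fin K) : 0 < ‖r i‖ := lt_of_le_of_lt (Real.sqrt_nonneg _) (hrnorm i)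
  set e : Fin K → H := fun i ↦ ‖r i‖⁻¹ • r i with he
  have hrmem {i j : Fin K} (hij : i < j) : r i ∈ kernelSpan H (firstPoints x (N + j)) :=
    kernelResidual_mem (firstPoints_mono x (by have := Fin.lt_def.1 hij; omega))
      (mem_firstPoints x (by have := Fin.lt_def.1 hij; omega))
  have hrr {i j : Fin K} (hij : i < j) : ⟪r j, r i⟫ = 0 := inner_kernelResidual_of_mem (hrmem hij)
  have hortho : Orthonormal ℝ e := by
    refine ⟨fun i ↦ norm_smul_inv_norm (norm_pos_iff.1 (hrpos i)), fun i j hij ↦ ?_⟩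
    simp only [he]
    rw [real_inner_smul_left, real_inner_smul_right]
    rcases lt_or_gt_of_ne hij with h | h
    · rw [real_inner_comm, hrr h]; simp
    · rw [hrr h]; simp
  obtain ⟨i, hi⟩ := exists_abs_diag_le_of_approx hK hortho
    (v := fun i ↦ kernelTranslate H (x (N + i))) (fun i j hij ↦ by
      rw [he, real_inner_smul_left, hr, inner_kernelResidual_of_mem
        (kernelTranslate_mem_kernelSpan (mem_firstPoints x (by
          have := Fin.lt_def.1 hij; omega))), mul_zero]) hδ hδs (fun i ↦ by
      -- Each `e j` is orthogonal to `V(X_N)`, so the translate may be replaced by its residual at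
      -- stage `N`; Bessel's inequality then gives the bound by `s` rather than by the full norm of
      -- the translate.
      have h1 (j : Fin K) : ⟪e j, kernelTranslate H (x (N + i))⟫ =
          ⟪e j, kernelResidual H (firstPoints x N) (x (N + i))⟫ := by
        conv_rhs => rw [kernelResidual, inner_sub_right]
        have : ⟪e j, (kernelSpan H (firstPoints x N)).starProjection
            (kernelTranslate H (x (N + i)))⟫ = 0 := by
          rw [he, real_inner_smul_left, hr, inner_kernelResidual_of_mem, mul_zero]
          exact kernelSpan_mono (firstPoints_mono x (by omega))
            (Submodule.starProjection_apply_mem _ _)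
        rw [this, sub_zero]
      simp only [h1]
      have h2 := hortho.sum_inner_products_le
        (x := kernelResidual H (firstPoints x N) (x (N + i))) (s := Finset.univ)
      simp only [Real.norm_eq_abs, sq_abs] at h2
      refine h2.trans ?_
      rw [← powerFunction_eq_norm_kernelResidual]
      exact pow_le_pow_left₀ (powerFunction_nonneg _ _) (hs _) 2) W hW (fun i ↦ hWδ _)
  have h3 : ⟪e i, kernelTranslate H (x (N + i))⟫ = ‖r i‖ := by
    rw [he, real_inner_smul_left]
    simp only [hr]
    rw [inner_kernelResidual_self, sq, inv_mul_cancel_left₀]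
    exact (hrpos i).ne'
  rw [h3, abs_of_pos (hrpos i)] at hi
  exact absurd hi (not_le.2 (hrnorm i))

/-- A block of steps of a stabilized greedy algorithm. -/
lemma IsStabilizedGreedy.powerFunction_le {γ : ℝ} (hγ : 0 < γ) {η : ℕ → X → ℝ≥0} {M : ℕ∞}
    {x : ℕ → X} (hx : IsStabilizedGreedy H γ η M x) {N K : ℕ} (hNK : ((N + K : ℕ) : ℕ∞) ≤ M)
    (hK : 0 < K) {s δ : ℝ} (hδ : 0 < δ) (hδs : δ ≤ s)
    (hs : ∀ y, powerFunction H (firstPoints x N) y ≤ s)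
    (W : Submodule ℝ H) [FiniteDimensional ℝ W] (hW : 2 * Module.finrank ℝ W ≤ K)
    (hWδ : ∀ y, ∃ w ∈ W, ‖kernelTranslate H y - w‖ ≤ δ) (y : X) :
    powerFunction H (firstPoints x (N + K)) y ≤ √(2 * s * δ) / γ := by
  obtain ⟨i, hi, hle⟩ := exists_powerFunction_le_of_approx x N hK hδ hδs hs W hW hWδ
  have hlt : ((N + i : ℕ) : ℕ∞) < M :=
    lt_of_lt_of_le (by exact_mod_cast (by omega : N + i < N + K)) hNK
  have h1 := mul_powerFunction_le_of_mem_restrictedSet hγ.le (hx (N + i) hlt).1 y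
  rw [le_div_iff₀ hγ, mul_comm]
  refine le_trans ?_ (h1.trans hle)
  gcongr
  exact powerFunction_anti (firstPoints_mono x (by omega)) y

end PowerFunction

/-! ### The convergence rate -/

lemma IsNativeSpace.norm_kernelTranslate_eq {X : Type*} {H : Type*} [NormedAddCommGroup H]
    [InnerProductSpace ℝ H] [CompleteSpace H] [RKHS ℝ H X ℝ] {k : X → X → ℝ}
    (hH : IsNativeSpace H k) (x : X) : ‖kernelTranslate H x‖ = √(k x x) := by
  obtain ⟨kx, hk, hrep⟩ := hH x
  have h : kernelTranslate H x = kx := ext_inner_right ℝ fun f ↦ by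
    rw [inner_kernelTranslate, real_inner_comm, hrep]
  rw [h, ← hk, ← hrep, real_inner_self_eq_norm_sq, Real.sqrt_sq (norm_nonneg _)]

section Rate

variable {X : Type*} {H : Type*} [NormedAddCommGroup H] [InnerProductSpace ℝ H] [CompleteSpace H]
  [RKHS ℝ H X ℝ]

/-- Algebraic decay of the widths along a geometric sequence of dimensions passes to the Power
functions of stabilized greedy algorithms. -/
lemma IsStabilizedGreedy.powerFunction_le_geometric {d n : ℕ} (hd : 0 < d) (hn : 0 < n)
    {β C A : ℝ} (hC : 0 < C) (hA : 2 * C * (2 ^ β * 2 ^ β) ≤ A) (hCA : C ≤ A)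
    (hB : ∀ x, ‖kernelTranslate H x‖ ≤ A)
    (hW : ∀ L : ℕ, 0 < L → ∃ W : Submodule ℝ H, FiniteDimensional ℝ W ∧
      Module.finrank ℝ W ≤ (L * n) ^ d ∧
        ∀ x, ∃ w ∈ W, ‖kernelTranslate H x - w‖ ≤ C * (L : ℝ) ^ (-β))
    {γ : ℝ} (hγ : 0 < γ) (hγ1 : γ ≤ 1) {η : ℕ → X → ℝ≥0} {M : ℕ∞} {x : ℕ → X}
    (hx : IsStabilizedGreedy H γ η M x) (l : ℕ) (hl : ((2 * (2 ^ l * n) ^ d : ℕ) : ℕ∞) ≤ M)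
    (y : X) : powerFunction H (firstPoints x (2 * (2 ^ l * n) ^ d)) y ≤
      A / γ ^ 2 * ((2 : ℝ) ^ (-β)) ^ l := by
  have hA0 : 0 < A := hC.trans_le hCA
  have hAγ : A ≤ A / γ ^ 2 := by
    rw [le_div_iff₀ (by positivity)]
    exact mul_le_of_le_one_right hA0.le (pow_le_one₀ hγ.le hγ1)
  have hq : (0 : ℝ) < 2 ^ (-β) := by positivity
  induction l generalizing y with
  | zero =>
    rw [pow_zero ((2 : ℝ) ^ (-β)), mul_one]
    exact (powerFunction_le_norm _ _).trans ((hB y).trans hAγ)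
  | succ l ih =>
    obtain ⟨W, hWfin, hWrank, hWδ⟩ := hW (2 ^ l) (by positivity)
    -- As `d ≥ 1`, the dimension count at least doubles, so the block has length at least `2 * (2 ^
    -- l * n) ^ d`, twice the dimension bound for `W`.
    have hstep : 4 * (2 ^ l * n) ^ d ≤ 2 * (2 ^ (l + 1) * n) ^ d := by
      have : 2 ^ (l + 1) * n = 2 * (2 ^ l * n) := by ring
      rw [this, mul_pow 2]
      have h2 : 2 ≤ 2 ^ d := by
        calc 2 = 2 ^ 1 := by norm_num
          _ ≤ 2 ^ d := Nat.pow_le_pow_right (by norm_num) hd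
      calc 4 * (2 ^ l * n) ^ d = 2 * (2 * (2 ^ l * n) ^ d) := by ring
        _ ≤ _ := by gcongr
    have hpos : 0 < (2 ^ l * n) ^ d := by positivity
    set N := 2 * (2 ^ l * n) ^ d with hN
    obtain ⟨K, hK⟩ := Nat.exists_eq_add_of_le (show N ≤ 2 * (2 ^ (l + 1) * n) ^ d by omega)
    rw [hK] at hl ⊢
    have hδ : ((2 ^ l : ℕ) : ℝ) ^ (-β) = ((2 : ℝ) ^ (-β)) ^ l := by
      rw [Nat.cast_pow, Nat.cast_ofNat, ← Real.rpow_natCast, ← Real.rpow_natCast,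
        ← Real.rpow_mul (by norm_num), ← Real.rpow_mul (by norm_num), mul_comm]
    rw [hδ] at hWδ
    set Q := ((2 : ℝ) ^ (-β)) ^ l with hQ
    have hQ0 : 0 < Q := by positivity
    have h := hx.powerFunction_le hγ (N := N) (K := K) hl (by omega) (s := A / γ ^ 2 * Q)
      (δ := C * Q) (by positivity) (by gcongr; exact hCA.trans hAγ)
      (fun y ↦ ih (le_trans (by exact_mod_cast Nat.le_add_right N K) hl) y) W (by omega) hWδ y
    refine h.trans ?_
    rw [div_le_iff₀ hγ]
    refine Real.sqrt_le_iff.2 ⟨by positivity, ?_⟩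
    have hinv : (2 : ℝ) ^ (-β) * 2 ^ β = 1 := by
      rw [← Real.rpow_add (by norm_num), neg_add_cancel, Real.rpow_zero]
    -- This closes the induction: `A` must be large enough to pay for one halving of scale under the
    -- square root.
    have h1 : 2 * C ≤ A * (2 ^ (-β) * 2 ^ (-β)) := by
      calc 2 * C = 2 * C * (2 ^ β * 2 ^ β) * (2 ^ (-β) * 2 ^ (-β)) := by
            rw [show 2 * C * ((2 : ℝ) ^ β * 2 ^ β) * (2 ^ (-β) * 2 ^ (-β)) =
              2 * C * ((2 ^ (-β) * 2 ^ β) * (2 ^ (-β) * 2 ^ β)) by ring, hinv]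
            ring
        _ ≤ _ := by gcongr
    calc 2 * (A / γ ^ 2 * Q) * (C * Q) = A / γ ^ 2 * Q ^ 2 * (2 * C) := by ring
      _ ≤ A / γ ^ 2 * Q ^ 2 * (A * (2 ^ (-β) * 2 ^ (-β))) := by gcongr
      _ = _ := by
        rw [pow_succ ((2 : ℝ) ^ (-β)) l, ← hQ]
        field_simp

end Rate

end

/-! ### From the geometric subsequence to all `N`. -/

theorem mainTheorem1 {d : ℕ} (hd : 0 < d) (Ω : Set (EuclideanSpace ℝ (Fin d)))
    (hcompact : IsCompact Ω) (hcone : InteriorConeCondition Ω) (hlip : HasLipschitzBoundary Ω)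
    (k : Ω → Ω → ℝ) (hk : IsStrictlyPosDefKernel k) (htrans : IsTranslationInvariant k)
    {H : Type*} [NormedAddCommGroup H] [InnerProductSpace ℝ H] [CompleteSpace H] [RKHS ℝ H Ω ℝ]
    (hH : IsNativeSpace H k)
    (τ : ℝ) (hτ : (d : ℝ) / 2 < τ) (hsmooth : HasFiniteSmoothness H τ) :
    ∃ c₁ : ℝ, 0 < c₁ ∧
      ∀ (γ : ℝ), 0 < γ → γ ≤ 1 →
      ∀ (η : ℕ → Ω → ℝ≥0) (M : ℕ∞) (x : ℕ → Ω), IsStabilizedGreedy H γ η M x →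
      ∀ N : ℕ, 1 ≤ N → (N : ℕ∞) ≤ M →
        supNorm (powerFunction H (firstPoints x N)) ≤
            ENNReal.ofReal ((2 : ℝ) ^ (5 * τ / d - 1 / 2) * c₁ * γ ^ (-2 : ℤ) *
              (N : ℝ) ^ (1 / 2 - τ / d)) ∧
          ∀ f : H, supNorm (fun y : Ω ↦ f y - interpolant H (firstPoints x N) f y) ≤
            ENNReal.ofReal ((2 : ℝ) ^ (5 * τ / d - 1 / 2) * c₁ * γ ^ (-2 : ℤ) *
              (N : ℝ) ^ (1 / 2 - τ / d) * ‖f‖) := by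
  obtain ⟨Φ, hΦ⟩ := htrans
  have hB (x : Ω) : ‖kernelTranslate H x‖ ≤ √(Φ 0) := by
    rw [hH.norm_kernelTranslate_eq, hΦ, sub_self]
  obtain ⟨C, hC, hW⟩ :=
    exists_subspace_approximating_kernelTranslate hcompact hcone hτ hsmooth hB
  set β := τ - d / 2 with hβ
  set α := τ / d - 1 / 2 with hα
  have hβ0 : 0 < β := sub_pos.2 hτ
  have hdr : (0 : ℝ) < d := by exact_mod_cast hd
  have hβα : β = d * α := by rw [hβ, hα]; field_simp
  have hα0 : 0 < α := by
    by_contra h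
    push Not at h
    nlinarith
  set n := ⌊τ⌋₊ + 1 with hn
  set A := 2 * C * (2 ^ β * 2 ^ β) + C + √(Φ 0) with hA
  have hA0 : 0 < A := by positivity
  set N₀ : ℝ := 2 * (n : ℝ) ^ d with hN₀
  have hN₀pos : 0 < N₀ := by positivity
  have hE : (0 : ℝ) < 2 ^ (5 * τ / d - 1 / 2) := by positivity
  -- The division cancels the prescribed power of two. `N₀ ^ α` comes from the first dimension `2 *
  -- n ^ d`, and `2 ^ β` pays for the gap between two consecutive dimensions.
  refine ⟨A * N₀ ^ α * 2 ^ β / 2 ^ (5 * τ / d - 1 / 2), by positivity, ?_⟩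
  intro γ hγ hγ1 η M x hx N hN hNM
  have hNr : (0 : ℝ) < N := by exact_mod_cast hN
  have hexp : (1 / 2 - τ / d : ℝ) = -α := by rw [hα]; ring
  rw [mul_div_cancel₀ _ hE.ne', hexp]
  have hγ2 : γ ^ (-2 : ℤ) = 1 / γ ^ 2 := by
    rw [zpow_neg, one_div]
    rfl
  rw [hγ2]
  have key (y : Ω) : powerFunction H (firstPoints x N) y ≤
      A * N₀ ^ α * 2 ^ β * (1 / γ ^ 2) * (N : ℝ) ^ (-α) := by
    have hex : ∃ l : ℕ, N < 2 * (2 ^ l * n) ^ d := by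
      refine ⟨N, lt_of_lt_of_le N.lt_two_pow_self ?_⟩
      calc 2 ^ N ≤ 2 ^ N * n := Nat.le_mul_of_pos_right _ (by omega)
        _ ≤ (2 ^ N * n) ^ d := Nat.le_self_pow hd.ne' _
        _ ≤ _ := by omega
    classical
    -- With `l` minimal, `N` lies between the dimensions of index `l - 1` and `l`: the former gives
    -- the estimate, the latter converts it into a power of `N`. For `l = 0` the bound on the kernel
    -- translates suffices.
    obtain ⟨l, hl, hmin⟩ : ∃ l : ℕ, N < 2 * (2 ^ l * n) ^ d ∧
        ∀ l' < l, ¬ N < 2 * (2 ^ l' * n) ^ d :=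
      ⟨Nat.find hex, Nat.find_spec hex, fun _ h ↦ Nat.find_min hex h⟩
    have hNle : (N : ℝ) ≤ N₀ * (2 ^ l) ^ d := by
      have : (N : ℝ) ≤ ((2 * (2 ^ l * n) ^ d : ℕ) : ℝ) := by exact_mod_cast hl.le
      refine this.trans (le_of_eq ?_)
      push_cast
      rw [hN₀, mul_pow]
      ring
    have hN' : N₀ ^ (-α) * ((2 : ℝ) ^ (-β)) ^ l ≤ (N : ℝ) ^ (-α) := by
      refine le_trans (le_of_eq ?_) (Real.rpow_le_rpow_of_nonpos hNr hNle (by linarith))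
      rw [Real.mul_rpow hN₀pos.le (by positivity), ← Real.rpow_natCast, ← Real.rpow_natCast,
        ← Real.rpow_natCast, ← Real.rpow_mul (by norm_num), ← Real.rpow_mul (by norm_num),
        ← Real.rpow_mul (by norm_num), hβα]
      congr 2
      ring
    have hN₀inv : N₀ ^ α * N₀ ^ (-α) = 1 := by
      rw [← Real.rpow_add hN₀pos, add_neg_cancel, Real.rpow_zero]
    have h2inv : (2 : ℝ) ^ β * 2 ^ (-β) = 1 := by
      rw [← Real.rpow_add (by norm_num), add_neg_cancel, Real.rpow_zero]
    have hlow : A * (1 / γ ^ 2) * (2 ^ β * ((2 : ℝ) ^ (-β)) ^ l) ≤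
        A * N₀ ^ α * 2 ^ β * (1 / γ ^ 2) * (N : ℝ) ^ (-α) := by
      calc A * (1 / γ ^ 2) * (2 ^ β * ((2 : ℝ) ^ (-β)) ^ l)
          = A * (1 / γ ^ 2) * (2 ^ β * ((2 : ℝ) ^ (-β)) ^ l) * (N₀ ^ α * N₀ ^ (-α)) := by
            rw [hN₀inv, mul_one]
        _ = A * N₀ ^ α * 2 ^ β * (1 / γ ^ 2) * (N₀ ^ (-α) * ((2 : ℝ) ^ (-β)) ^ l) := by ring
        _ ≤ _ := by gcongr
    refine le_trans ?_ hlow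
    have hcast := Real.sqrt_nonneg (Φ 0)
    rcases l with _ | l
    · rw [pow_zero ((2 : ℝ) ^ (-β)), mul_one]
      have h1 : (1 : ℝ) ≤ 2 ^ β := Real.one_le_rpow (by norm_num) hβ0.le
      have h2 : 1 ≤ 1 / γ ^ 2 := by
        rw [le_div_iff₀ (by positivity), one_mul]
        exact pow_le_one₀ hγ.le hγ1
      have h3 : ‖kernelTranslate H y‖ ≤ A := (hB y).trans (by
        have : 0 < 2 * C * ((2 : ℝ) ^ β * 2 ^ β) + C := by positivity
        linarith)
      calc powerFunction H (firstPoints x N) y ≤ A := (powerFunction_le_norm _ _).trans h3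
        _ = A * 1 * 1 := by ring
        _ ≤ _ := by gcongr
    · have hle : 2 * (2 ^ l * n) ^ d ≤ N := not_lt.1 (hmin l (Nat.lt_succ_self l))
      have hCpos : 0 < 2 * C * ((2 : ℝ) ^ β * 2 ^ β) := by positivity
      have h := hx.powerFunction_le_geometric hd (Nat.succ_pos ⌊τ⌋₊) hC (A := A) (β := β)
        (by linarith) (by linarith) (fun y ↦ (hB y).trans (by linarith)) hW hγ hγ1 l
        (le_trans (by exact_mod_cast hle) hNM) y
      refine (powerFunction_anti (firstPoints_mono x hle) y).trans (h.trans (le_of_eq ?_))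
      rw [pow_succ ((2 : ℝ) ^ (-β)) l,
        show (2 : ℝ) ^ β * (((2 : ℝ) ^ (-β)) ^ l * 2 ^ (-β)) =
          (2 ^ β * 2 ^ (-β)) * ((2 : ℝ) ^ (-β)) ^ l by ring, h2inv]
      ring
  refine ⟨supNorm_le_ofReal fun y ↦ ?_, fun f ↦ supNorm_le_ofReal fun y ↦ ?_⟩
  · rw [abs_of_nonneg (powerFunction_nonneg _ _)]
    exact key y
  · exact (abs_sub_interpolant_le _ f y).trans (by gcongr; exact key y)
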